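/- Let $A\in\mathbb R^{m\times n}$, $B\in\mathbb R^{\nu\times n}$, $\sigma>0$, and let $S\in\mathbb R^{n\times n}$ be symmetric positive semidefinite. Let $\mathcal X\subset\mathbb R^n$ be an ellitope, $$\mathcal X=\{x=Py:\ y\in\mathbb R^{\bar n},\ \exists t\in\mathcal T:\ y^TS_ky\le t_k,\ 1\le k\le K\},$$ where $P\in\mathbb R^{n\times\bar n}$, the $\bar n\times\bar n$ matrices $S_k\succeq0$ satisfy $\sum_kS_k\succ0$, and $\mathcal T\subset\mathbb R^K_+$ is a convex compact set that contains a vector with all entries positive and is monotone ($0\le s\le t$ and $t\in\mathcal T$ imply $s\in\mathcal T$). Assume $BP\neq0$, and put $\bar A=AP$, $\bar B=BP$, $\bar S=P^TSP$ (so that these are $A,B,S$ when $P=I$). One observes $\omega=Ax+\sigma\xi$ with $\xi\sim\mathcal N(0,I_m)$ and unknown $x\in\mathcal X$. The $S$-risk of a Borel estimate $\widehat w:\mathbb R^m\to\mathbb R^\nu$ of $Bx$ is $$\mathrm{RiskS}[\widehat w|\mathcal X]=\inf\{\sqrt\tau:\ \tau\ge 0,\ \mathbf E\|\widehat w(Ax+\sigma\xi)-Bx\|_2^2\le\tau(1+x^TSx)\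 \ \forall x\in\mathcal X\},$$ with $\inf\emptyset=\infty$, and the minimax $S$-risk $\mathrm{RiskS}_{\rm opt}[\mathcal X]$ is the infimum of $\mathrm{RiskS}[\widehat w|\mathcal X]$ over all Borel $\widehat w$. Consider the convex program in $\tau\in\mathbb R$, $H\in\mathbb R^{m\times\nu}$, $\lambda\in\mathbb R^K$ $$\min_{\tau,H,\lambda}\Big\{\tau:\ \begin{bmatrix}\sum_k\lambda_kS_k+\tau \bar S&\bar B^T-\bar A^TH\\ \bar B-H^T\bar A&I_\nu\end{bmatrix}\succeq0,\ \sigma^2\mathrm{Tr}(H^TH)+\max_{t\in\mathcal T}\lambda^Tt\le\tau,\ \lambda\ge0\Big\},$$ and let $$M_*=\Big(\max\{\mathrm{Tr}(\bar BQ\bar B^T):\ Q\succeq0,\ \exists t\in\mathcal T:\ \mathrm{Tr}(QS_k)\le t_k,\ 1\le k\le K\}\Big)^{1/2}.$$ Then the program is solvable, the maximum that defines $M_*$ is attained, $0<\mathrm{RiskS}_{\rm opt}[\mathcal X]<\infty$, and for every optimal solution $(\tau_*,H_*,\lambda_*)$ of the program the linear estimate $\widehat w_{H_*}(\omega)=H_*^T\omega$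 satisfies $$\mathrm{RiskS}[\widehat w_{H_*}|\mathcal X]\le\sqrt{6\ln\Big(\frac{8KM_*^2}{\mathrm{RiskS}_{\rm opt}^2[\mathcal X]}\Big)}\ \mathrm{RiskS}_{\rm opt}[\mathcal X].$$ -/

import Mathlib

open MeasureTheory ProbabilityTheory Matrix
open scoped ENNReal

noncomputable section

/-- The requirements on the data `[{S_k}, 𝒯]` of an ellitopic representation: `S_k ⪰ 0`,
`∑ S_k ≻ 0`, and `𝒯` is a convex compact monotone subset of `ℝ₊^K` which meets the interior
of `ℝ₊^K`. -/
structure IsEllitopicData {N K : ℕ} (Sk : Fin K → Matrix (Fin N) (Fin N) ℝ)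
    (T : Set (Fin K → ℝ)) : Prop where
  posSemidef : ∀ k, (Sk k).PosSemidef
  posDef_sum : (∑ k, Sk k).PosDef
  convex : Convex ℝ T
  isCompact : IsCompact T
  nonneg : ∀ t ∈ T, ∀ k, 0 ≤ t k
  meets_interior : ∃ t ∈ T, ∀ k, 0 < t k
  monotone : ∀ t ∈ T, ∀ s : Fin K → ℝ, (∀ k, 0 ≤ s k) → (∀ k, s k ≤ t k) → s ∈ T

/-- The set `{x : ∃ y, ∃ t ∈ 𝒯, x = P y, yᵀ S_k y ≤ t_k for all k}`. -/
def ellitope {n N K : ℕ} (P : Matrix (Fin n) (Fin N) ℝ)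
    (Sk : Fin K → Matrix (Fin N) (Fin N) ℝ) (T : Set (Fin K → ℝ)) : Set (Fin n → ℝ) :=
  {x | ∃ y : Fin N → ℝ, ∃ t ∈ T, x = P *ᵥ y ∧ ∀ k, y ⬝ᵥ (Sk k *ᵥ y) ≤ t k}

/-- The standard Gaussian distribution `𝒩(0, I_m)` on `ℝ^m`. -/
def stdNormal (m : ℕ) : Measure (Fin m → ℝ) :=
  Measure.pi fun _ => gaussianReal 0 1

/-- The expected squared Euclidean error `E ‖ŵ(A x + σ ξ) - B x‖₂²`, `ξ ∼ 𝒩(0, I_m)`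
(possibly `∞`). -/
def meanSqError {n m ν : ℕ} (A : Matrix (Fin m) (Fin n) ℝ) (B : Matrix (Fin ν) (Fin n) ℝ)
    (σ : ℝ) (what : (Fin m → ℝ) → (Fin ν → ℝ)) (x : Fin n → ℝ) : ℝ≥0∞ :=
  ∫⁻ ξ, ENNReal.ofReal (∑ i, (what (A *ᵥ x + σ • ξ) i - (B *ᵥ x) i) ^ 2) ∂(stdNormal m)

/-- The `S`-risk of the estimate `ŵ` on `X`: the infimum of `√τ` over the `τ ≥ 0` with
`E ‖ŵ(A x + σ ξ) - B x‖₂² ≤ τ (1 + xᵀ S x)` for all `x ∈ X` (it is `∞` if there is none). -/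
def riskS {n m ν : ℕ} (A : Matrix (Fin m) (Fin n) ℝ) (B : Matrix (Fin ν) (Fin n) ℝ)
    (S : Matrix (Fin n) (Fin n) ℝ) (σ : ℝ) (X : Set (Fin n → ℝ))
    (what : (Fin m → ℝ) → (Fin ν → ℝ)) : ℝ≥0∞ :=
  ⨅ (τ : ℝ) (_ : 0 ≤ τ ∧ ∀ x ∈ X,
    meanSqError A B σ what x ≤ ENNReal.ofReal (τ * (1 + x ⬝ᵥ (S *ᵥ x)))),
    ENNReal.ofReal (Real.sqrt τ)

/-- The minimax `S`-risk on `X`: the infimum of the `S`-risk over all Borel estimates. -/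
def riskSOpt {n m ν : ℕ} (A : Matrix (Fin m) (Fin n) ℝ) (B : Matrix (Fin ν) (Fin n) ℝ)
    (S : Matrix (Fin n) (Fin n) ℝ) (σ : ℝ) (X : Set (Fin n → ℝ)) : ℝ≥0∞ :=
  ⨅ (what : (Fin m → ℝ) → (Fin ν → ℝ)) (_ : Measurable what), riskS A B S σ X what

/-- The linear estimate `ŵ_H(ω) = Hᵀ ω`. -/
def linearEstimate {m ν : ℕ} (H : Matrix (Fin m) (Fin ν) ℝ) (ω : Fin m → ℝ) : Fin ν → ℝ :=
  Hᵀ *ᵥ ω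

/-- The support function `φ_𝒯(λ) = max_{t ∈ 𝒯} λᵀ t`. -/
def supportFn {K : ℕ} (T : Set (Fin K → ℝ)) (lam : Fin K → ℝ) : ℝ :=
  sSup ((fun t => lam ⬝ᵥ t) '' T)

/-- Feasibility of `(τ, H, λ)` for the convex design program: minimize `τ` subject to
`[∑ λ_k S_k + τ S, Bᵀ - Aᵀ H; B - Hᵀ A, I_ν] ⪰ 0`, `σ² Tr(Hᵀ H) + φ_𝒯(λ) ≤ τ`, `λ ≥ 0`. -/
structure DesignFeasible {N m ν K : ℕ} (A : Matrix (Fin m) (Fin N) ℝ)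
    (B : Matrix (Fin ν) (Fin N) ℝ) (S : Matrix (Fin N) (Fin N) ℝ) (σ : ℝ)
    (Sk : Fin K → Matrix (Fin N) (Fin N) ℝ) (T : Set (Fin K → ℝ))
    (τ : ℝ) (H : Matrix (Fin m) (Fin ν) ℝ) (lam : Fin K → ℝ) : Prop where
  lmi : (fromBlocks (∑ k, lam k • Sk k + τ • S) (Bᵀ - Aᵀ * H) (B - Hᵀ * A)
    (1 : Matrix (Fin ν) (Fin ν) ℝ)).PosSemidef
  bound : σ ^ 2 * (Hᵀ * H).trace + supportFn T lam ≤ τ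
  nonneg : ∀ k, 0 ≤ lam k

/-- `(τ, H, λ)` is an optimal solution of the design program. -/
def DesignOptimal {N m ν K : ℕ} (A : Matrix (Fin m) (Fin N) ℝ)
    (B : Matrix (Fin ν) (Fin N) ℝ) (S : Matrix (Fin N) (Fin N) ℝ) (σ : ℝ)
    (Sk : Fin K → Matrix (Fin N) (Fin N) ℝ) (T : Set (Fin K → ℝ))
    (τ : ℝ) (H : Matrix (Fin m) (Fin ν) ℝ) (lam : Fin K → ℝ) : Prop :=
  DesignFeasible A B S σ Sk T τ H lam ∧
    ∀ (τ' : ℝ) (H' : Matrix (Fin m) (Fin ν) ℝ) (lam' : Fin K → ℝ),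
      DesignFeasible A B S σ Sk T τ' H' lam' → τ ≤ τ'

/-- The values `Tr(B Q Bᵀ)` over `𝒬 = {Q ⪰ 0 : ∃ t ∈ 𝒯, Tr(Q S_k) ≤ t_k for all k}`. -/
def traceValues {N ν K : ℕ} (B : Matrix (Fin ν) (Fin N) ℝ)
    (Sk : Fin K → Matrix (Fin N) (Fin N) ℝ) (T : Set (Fin K → ℝ)) : Set ℝ :=
  (fun Q : Matrix (Fin N) (Fin N) ℝ => (B * Q * Bᵀ).trace) ''
    {Q | Q.PosSemidef ∧ ∃ t ∈ T, ∀ k, (Q * Sk k).trace ≤ t k}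

/-- `M_* = √(max_{Q ∈ 𝒬} Tr(B Q Bᵀ))`. -/
def Mstar {N ν K : ℕ} (B : Matrix (Fin ν) (Fin N) ℝ)
    (Sk : Fin K → Matrix (Fin N) (Fin N) ℝ) (T : Set (Fin K → ℝ)) : ℝ :=
  Real.sqrt (sSup (traceValues B Sk T))

end

/-! By minimax duality, a value `τ` below the optimum of the design program comes with a least
favourable covariance `Q`: `Tr(Q S_k) ≤ t_k` for some `t ∈ T`, and every linear estimate has Bayes
risk at least `τ (1 + Tr(Q S))` under the prior `𝒩(0, Q)`. For a Gaussian prior no Borel estimate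
beats the best linear one, because its residual is independent of the observation. The prior
`𝒩(0, Q)` need not live on the ellitope, but `𝒩(0, δ Q)` violates a given constraint only with
probability of order `exp (-1 / (3 δ))`, and on that event the error of an estimate clipped to the
ball of radius `M_*` is controlled by a Gaussian moment. Hence
`δ τ ≤ RiskS_opt² + O(K M_*² exp (-1 / (3 δ)))`, and `δ = 1 / (3 log (8 K M_*² / RiskS_opt²))` makes
the remainder at most `RiskS_opt²`, which gives the factor `6 log (⋯)`. -/

section Matrices

variable {ι κ : Type*} [Fintype ι] [Fintype κ] {M Q : Matrix ι ι ℝ}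

theorem posSemidef_iff_transpose_eq_and_quadForm_nonneg :
    M.PosSemidef ↔ Mᵀ = M ∧ ∀ x : ι → ℝ, 0 ≤ x ⬝ᵥ (M *ᵥ x) := by
  rw [posSemidef_iff_dotProduct_mulVec, IsHermitian, conjTranspose_eq_transpose_of_trivial]
  simp only [star_trivial]

theorem quadForm_nonneg (hM : M.PosSemidef) (x : ι → ℝ) : 0 ≤ x ⬝ᵥ (M *ᵥ x) :=
  (posSemidef_iff_transpose_eq_and_quadForm_nonneg.1 hM).2 x

theorem dotProduct_self_nonneg (x : ι → ℝ) : 0 ≤ x ⬝ᵥ x :=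
  Finset.sum_nonneg fun _ _ => mul_self_nonneg _

theorem dotProduct_self_pos {x : ι → ℝ} (hx : x ≠ 0) : 0 < x ⬝ᵥ x := by
  simpa using dotProduct_star_self_pos_iff.2 hx

theorem mulVec_dotProduct_mulVec_self (E : Matrix κ ι ℝ) (x : ι → ℝ) :
    (E *ᵥ x) ⬝ᵥ (E *ᵥ x) = x ⬝ᵥ ((Eᵀ * E) *ᵥ x) := by
  rw [← mulVec_mulVec, dotProduct_mulVec x, vecMul_transpose]

theorem quadForm_sum_smul (c : κ → ℝ) (F : κ → Matrix ι ι ℝ) (x : ι → ℝ) :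
    x ⬝ᵥ ((∑ k, c k • F k) *ᵥ x) = ∑ k, c k * (x ⬝ᵥ (F k *ᵥ x)) := by
  simp only [sum_mulVec, dotProduct_sum, smul_mulVec, dotProduct_smul, smul_eq_mul]

theorem quadForm_sum (F : κ → Matrix ι ι ℝ) (x : ι → ℝ) :
    x ⬝ᵥ ((∑ k, F k) *ᵥ x) = ∑ k, x ⬝ᵥ (F k *ᵥ x) := by
  rw [sum_mulVec, dotProduct_sum]

theorem trace_vecMulVec_self_mul (x : ι → ℝ) (M : Matrix ι ι ℝ) :
    (vecMulVec x x * M).trace = x ⬝ᵥ (M *ᵥ x) := by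
  rw [trace_mul_comm, mul_vecMulVec, trace_vecMulVec, dotProduct_comm]

theorem trace_mul_transpose_self (E : Matrix κ ι ℝ) : (E * Eᵀ).trace = ∑ i, E i ⬝ᵥ E i := rfl

theorem trace_mul_transpose_self_nonneg (E : Matrix κ ι ℝ) : 0 ≤ (E * Eᵀ).trace :=
  Finset.sum_nonneg fun i _ => dotProduct_self_nonneg (E i)

theorem trace_transpose_mul_self_nonneg (E : Matrix κ ι ℝ) : 0 ≤ (Eᵀ * E).trace := by
  simpa only [transpose_transpose] using trace_mul_transpose_self_nonneg Eᵀ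

theorem sq_apply_le_trace_transpose_mul_self (E : Matrix κ ι ℝ) (i : κ) (j : ι) :
    E i j ^ 2 ≤ (Eᵀ * E).trace :=
  calc E i j ^ 2 = Eᵀ j i * Eᵀ j i := sq _
    _ ≤ Eᵀ j ⬝ᵥ Eᵀ j := Finset.single_le_sum (f := fun i => Eᵀ j i * Eᵀ j i)
        (fun _ _ => mul_self_nonneg _) (Finset.mem_univ i)
    _ ≤ (Eᵀ * E).trace := Finset.single_le_sum (f := fun j => Eᵀ j ⬝ᵥ Eᵀ j)
        (fun _ _ => dotProduct_self_nonneg _) (Finset.mem_univ j)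

theorem mulVec_dotProduct_self_le (E : Matrix κ ι ℝ) (x : ι → ℝ) :
    (E *ᵥ x) ⬝ᵥ (E *ᵥ x) ≤ (E * Eᵀ).trace * (x ⬝ᵥ x) := by
  rw [trace_mul_transpose_self, Finset.sum_mul]
  refine Finset.sum_le_sum fun i _ => ?_
  have h := Finset.sum_mul_sq_le_sq_mul_sq Finset.univ (E i) x
  simpa only [dotProduct, mulVec, sq] using h

theorem trace_mul_mul_transpose_nonneg (hQ : Q.PosSemidef) (E : Matrix κ ι ℝ) :
    0 ≤ (E * Q * Eᵀ).trace := by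
  simpa using (hQ.mul_mul_conjTranspose_same E).trace_nonneg

theorem exists_eq_mul_transpose (hQ : Q.PosSemidef) : ∃ C : Matrix ι ι ℝ, Q = C * Cᵀ := by
  classical
  open scoped MatrixOrder in
  obtain ⟨R, hR⟩ := CStarAlgebra.nonneg_iff_eq_star_mul_self.mp hQ.nonneg
  exact ⟨Rᵀ, by simpa [star_eq_conjTranspose] using hR⟩

theorem trace_mul_nonneg (hQ : Q.PosSemidef) (hM : M.PosSemidef) : 0 ≤ (Q * M).trace := by
  obtain ⟨C, rfl⟩ := exists_eq_mul_transpose hM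
  have h := trace_mul_mul_transpose_nonneg hQ Cᵀ
  rwa [transpose_transpose, trace_mul_cycle, trace_mul_comm] at h

theorem abs_apply_le_trace (hQ : Q.PosSemidef) (i j : ι) : |Q i j| ≤ Q.trace := by
  classical
  have hdiag (i : ι) : Q i i ≤ Q.trace :=
    Finset.single_le_sum (f := fun i => Q i i) (fun i _ => hQ.diag_nonneg) (Finset.mem_univ i)
  have hsymm : Q j i = Q i j :=
    congrFun₂ (posSemidef_iff_transpose_eq_and_quadForm_nonneg.1 hQ).1 i j
  have hadd := quadForm_nonneg hQ (Pi.single i 1 + Pi.single j 1)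
  have hsub := quadForm_nonneg hQ (Pi.single i 1 - Pi.single j 1)
  simp only [mulVec_add, mulVec_sub, mulVec_single_one, add_dotProduct, sub_dotProduct,
    single_one_dotProduct, Pi.add_apply, Pi.sub_apply, col_apply] at hadd hsub
  rw [abs_le]
  constructor <;> linarith [hdiag i, hdiag j]

theorem trace_mul_mul_transpose_convex (hQ : Q.PosSemidef) (X Y : Matrix κ ι ℝ) {a b : ℝ}
    (ha : 0 ≤ a) (hb : 0 ≤ b) (hab : a + b = 1) :
    ((a • X + b • Y) * Q * (a • X + b • Y)ᵀ).trace ≤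
      a * (X * Q * Xᵀ).trace + b * (Y * Q * Yᵀ).trace := by
  have h := mul_nonneg (mul_nonneg ha hb) (trace_mul_mul_transpose_nonneg hQ (X - Y))
  obtain rfl : b = 1 - a := by linarith
  simp only [transpose_add, transpose_smul, transpose_sub, Matrix.add_mul, Matrix.mul_add,
    Matrix.sub_mul, Matrix.mul_sub, trace_add, trace_sub, trace_smul, smul_mul, Matrix.mul_smul,
    smul_eq_mul] at h ⊢
  linarith

theorem exists_pos_posSemidef_sub_smul_one {α : Type*} [Finite α] [DecidableEq α]
    {M : Matrix α α ℝ} (hM : M.PosDef) :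
    ∃ c : ℝ, 0 < c ∧ (M - c • (1 : Matrix α α ℝ)).PosSemidef := by
  have := Fintype.ofFinite α
  open scoped MatrixOrder Matrix.Norms.L2Operator in
  rcases isEmpty_or_nonempty α with _ | _
  · exact ⟨1, one_pos, Subsingleton.elim 0 (M - _) ▸ PosSemidef.zero⟩
  have hpos := hM.isStrictlyPositive
  obtain ⟨c, hc, hle⟩ := (CFC.exists_pos_algebraMap_le_iff hpos.isSelfAdjoint).2
    fun _ hx => hpos.spectrum_pos hx
  exact ⟨c, hc, by simpa only [Algebra.algebraMap_eq_smul_one] using Matrix.le_iff.1 hle⟩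

theorem exists_mulVec_dotProduct_self_le_quadForm (hM : M.PosDef) (E : Matrix κ ι ℝ) :
    ∃ c : ℝ, 0 ≤ c ∧ ∀ x, (E *ᵥ x) ⬝ᵥ (E *ᵥ x) ≤ c * (x ⬝ᵥ (M *ᵥ x)) := by
  classical
  obtain ⟨c, hc, hMc⟩ := exists_pos_posSemidef_sub_smul_one hM
  have htr := trace_mul_transpose_self_nonneg E
  refine ⟨(E * Eᵀ).trace / c, by positivity, fun x => ?_⟩
  have hx : c * (x ⬝ᵥ x) ≤ x ⬝ᵥ (M *ᵥ x) := by
    simpa [sub_mulVec, smul_mulVec] using quadForm_nonneg hMc x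
  calc (E *ᵥ x) ⬝ᵥ (E *ᵥ x) ≤ (E * Eᵀ).trace * (x ⬝ᵥ x) := mulVec_dotProduct_self_le E x
    _ = (E * Eᵀ).trace / c * (c * (x ⬝ᵥ x)) := by field_simp
    _ ≤ _ := by gcongr

theorem posSemidef_fromBlocks_transpose_one_iff [DecidableEq κ] (hM : Mᵀ = M)
    (E : Matrix κ ι ℝ) :
    (fromBlocks M Eᵀ E 1).PosSemidef ↔ ∀ x, (E *ᵥ x) ⬝ᵥ (E *ᵥ x) ≤ x ⬝ᵥ (M *ᵥ x) := by
  have : Invertible (1 : Matrix κ κ ℝ) := invertibleOne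
  have h := PosDef.fromBlocks₂₂ M Eᵀ (PosDef.one (n := κ) (R := ℝ))
  rw [conjTranspose_eq_transpose_of_trivial, transpose_transpose, inv_one, Matrix.mul_one] at h
  rw [h, posSemidef_iff_transpose_eq_and_quadForm_nonneg,
    and_iff_right (by simp only [transpose_sub, transpose_mul, transpose_transpose, hM])]
  simp only [sub_mulVec, dotProduct_sub, sub_nonneg, mulVec_dotProduct_mulVec_self]

theorem isCompact_of_isClosed_of_abs_apply_le {α β : Type*} {s : Set (Matrix α β ℝ)}
    (hs : IsClosed s) {r : ℝ} (hr : ∀ E ∈ s, ∀ i j, |E i j| ≤ r) : IsCompact s :=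
  (isCompact_univ_pi fun _ => isCompact_univ_pi fun _ => isCompact_Icc).of_isClosed_subset hs
    fun E hE i _ j _ => abs_le.1 (hr E hE i j)

theorem isCompact_setOf_trace_transpose_mul_self_le (r : ℝ) :
    IsCompact {E : Matrix κ ι ℝ | (Eᵀ * E).trace ≤ r} :=
  isCompact_of_isClosed_of_abs_apply_le
    (isClosed_le (f := fun E : Matrix κ ι ℝ => (Eᵀ * E).trace) (by fun_prop) continuous_const)
    fun E hE i j => Real.abs_le_sqrt ((sq_apply_le_trace_transpose_mul_self E i j).trans hE)

/-- The section `{Q ⪰ 0 : Tr(Q M) ≤ r}` of the cone of positive semidefinite matrices, a compact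
convex set for `M ≻ 0`. It carries the covariances over which the design program is dualized. -/
def psdSection (M : Matrix ι ι ℝ) (r : ℝ) : Set (Matrix ι ι ℝ) :=
  {Q | Q.PosSemidef ∧ (Q * M).trace ≤ r}

theorem zero_mem_psdSection {r : ℝ} (hr : 0 ≤ r) : 0 ∈ psdSection M r :=
  ⟨PosSemidef.zero, by simpa using hr⟩

theorem convex_psdSection (M : Matrix ι ι ℝ) (r : ℝ) : Convex ℝ (psdSection M r) := by
  refine fun Q₁ h₁ Q₂ h₂ a b ha hb hab => ⟨(h₁.1.smul ha).add (h₂.1.smul hb), ?_⟩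
  calc ((a • Q₁ + b • Q₂) * M).trace = a * (Q₁ * M).trace + b * (Q₂ * M).trace := by
        simp only [Matrix.add_mul, smul_mul, trace_add, trace_smul, smul_eq_mul]
    _ ≤ a * r + b * r := by gcongr; exacts [h₁.2, h₂.2]
    _ = r := by rw [← add_mul, hab, one_mul]

theorem isClosed_psdSection (M : Matrix ι ι ℝ) (r : ℝ) : IsClosed (psdSection M r) := by
  simp only [psdSection, posSemidef_iff_transpose_eq_and_quadForm_nonneg, Set.ofPred_and,
    Set.ofPred_forall]
  refine ((isClosed_eq ?_ ?_).inter (isClosed_iInter fun x => isClosed_le ?_ ?_)).inter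
    (isClosed_le ?_ ?_) <;> fun_prop

theorem isCompact_psdSection (hM : M.PosDef) (r : ℝ) : IsCompact (psdSection M r) := by
  classical
  obtain ⟨c, hc, hMc⟩ := exists_pos_posSemidef_sub_smul_one hM
  refine isCompact_of_isClosed_of_abs_apply_le (r := r / c) (isClosed_psdSection M r)
    fun Q hQ i j => (abs_apply_le_trace hQ.1 i j).trans ?_
  have h : 0 ≤ (Q * M).trace - c * Q.trace := by
    simpa [Matrix.mul_sub] using trace_mul_nonneg hQ.1 hMc
  rw [le_div_iff₀ hc]
  linarith [hQ.2]

theorem quadForm_le_of_forall_mem_psdSection (hM : M.PosDef) {r : ℝ} (hr : 0 < r)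
    {W : Matrix ι ι ℝ} {μ : ℝ} (hW : ∀ Q ∈ psdSection M r, (Q * W).trace ≤ r * μ) (x : ι → ℝ) :
    x ⬝ᵥ (W *ᵥ x) ≤ μ * (x ⬝ᵥ (M *ᵥ x)) := by
  rcases eq_or_ne x 0 with rfl | hx
  · simp
  set s := x ⬝ᵥ (M *ᵥ x)
  have hs : 0 < s := by simpa using hM.dotProduct_mulVec_pos hx
  have htrace (G : Matrix ι ι ℝ) :
      (((r / s) • vecMulVec x x) * G).trace = r / s * (x ⬝ᵥ (G *ᵥ x)) := by
    rw [smul_mul, trace_smul, trace_vecMulVec_self_mul, smul_eq_mul]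
  have hmem : (r / s) • vecMulVec x x ∈ psdSection M r :=
    ⟨PosSemidef.smul (by simpa using posSemidef_vecMulVec_self_star x) (by positivity),
      (htrace M).trans_le (div_mul_cancel₀ r hs.ne').le⟩
  have h := hW _ hmem
  rw [htrace, div_mul_eq_mul_div, div_le_iff₀ hs, mul_assoc] at h
  exact le_of_mul_le_mul_left h hr

end Matrices

section DesignProgram

variable {N m ν K : ℕ} {A : Matrix (Fin m) (Fin N) ℝ} {B : Matrix (Fin ν) (Fin N) ℝ}
  {S : Matrix (Fin N) (Fin N) ℝ} {σ τ : ℝ} {Sk : Fin K → Matrix (Fin N) (Fin N) ℝ}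
  {T : Set (Fin K → ℝ)} {H : Matrix (Fin m) (Fin ν) ℝ} {lam : Fin K → ℝ}

namespace IsEllitopicData

theorem nonempty (hX : IsEllitopicData Sk T) : T.Nonempty :=
  hX.meets_interior.imp fun _ ht => ht.1

theorem supportFn_le_iff (hX : IsEllitopicData Sk T) {c : ℝ} :
    supportFn T lam ≤ c ↔ ∀ t ∈ T, lam ⬝ᵥ t ≤ c := by
  have hbdd : BddAbove ((fun t => lam ⬝ᵥ t) '' T) :=
    (hX.isCompact.image (by fun_prop)).bddAbove
  rw [supportFn, csSup_le_iff hbdd (hX.nonempty.image _), Set.forall_mem_image]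

theorem exists_sum_le (hX : IsEllitopicData Sk T) :
    ∃ r : ℝ, 0 < r ∧ ∀ t ∈ T, ∑ k, t k ≤ r := by
  obtain ⟨r, hr⟩ := (hX.isCompact.image
    (f := fun t : Fin K → ℝ => ∑ k, t k) (by fun_prop)).bddAbove
  exact ⟨max r 1, by positivity, fun t ht =>
    (hr (Set.mem_image_of_mem _ ht)).trans (le_max_left _ _)⟩

theorem dotProduct_nonneg (hX : IsEllitopicData Sk T) (hlam : ∀ k, 0 ≤ lam k) {t : Fin K → ℝ}
    (ht : t ∈ T) : 0 ≤ lam ⬝ᵥ t :=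
  Finset.sum_nonneg fun k _ => mul_nonneg (hlam k) (hX.nonneg t ht k)

theorem isCompact_setOf_trace_mul_le (hX : IsEllitopicData Sk T) :
    IsCompact {Q : Matrix (Fin N) (Fin N) ℝ |
      Q.PosSemidef ∧ ∃ t ∈ T, ∀ k, (Q * Sk k).trace ≤ t k} := by
  obtain ⟨r, -, hsum⟩ := hX.exists_sum_le
  have hcompact := ((isCompact_psdSection hX.posDef_sum r).prod hX.isCompact).inter_right
    (t := {p | ∀ k, (p.1 * Sk k).trace ≤ p.2 k}) (by
      simp only [Set.ofPred_forall]
      exact isClosed_iInter fun k => isClosed_le (by fun_prop) (by fun_prop))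
  convert hcompact.image continuous_fst using 1
  ext Q
  constructor
  · rintro ⟨hQ, t, ht, hle⟩
    refine ⟨(Q, t), ⟨⟨⟨hQ, ?_⟩, ht⟩, hle⟩, rfl⟩
    rw [Finset.mul_sum, trace_sum]
    exact (Finset.sum_le_sum fun k _ => hle k).trans (hsum t ht)
  · rintro ⟨⟨Q, t⟩, ⟨⟨⟨hQ, -⟩, ht⟩, hle⟩, rfl⟩
    exact ⟨hQ, t, ht, hle⟩

theorem isGreatest_Mstar_sq (hX : IsEllitopicData Sk T) (B : Matrix (Fin ν) (Fin N) ℝ) :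
    IsGreatest (traceValues B Sk T) (Mstar B Sk T ^ 2) := by
  obtain ⟨t, ht⟩ := hX.nonempty
  have hzero : (0 : ℝ) ∈ traceValues B Sk T :=
    ⟨0, ⟨PosSemidef.zero, t, ht, fun k => by simpa using hX.nonneg t ht k⟩, by simp⟩
  have hcompact : IsCompact (traceValues B Sk T) :=
    hX.isCompact_setOf_trace_mul_le.image
      (f := fun Q : Matrix (Fin N) (Fin N) ℝ => (B * Q * Bᵀ).trace) (by fun_prop)
  have hmax := hcompact.isGreatest_sSup ⟨0, hzero⟩
  rwa [Mstar, Real.sq_sqrt (hmax.2 hzero)]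

end IsEllitopicData

theorem designFeasible_iff (hX : IsEllitopicData Sk T) (hS : S.PosSemidef) :
    DesignFeasible A B S σ Sk T τ H lam ↔
      (∀ x : Fin N → ℝ, ((B - Hᵀ * A) *ᵥ x) ⬝ᵥ ((B - Hᵀ * A) *ᵥ x) ≤
        ∑ k, lam k * (x ⬝ᵥ (Sk k *ᵥ x)) + τ * (x ⬝ᵥ (S *ᵥ x))) ∧
      (∀ t ∈ T, σ ^ 2 * (Hᵀ * H).trace + lam ⬝ᵥ t ≤ τ) ∧ ∀ k, 0 ≤ lam k := by
  have hsymm : (∑ k, lam k • Sk k + τ • S)ᵀ = ∑ k, lam k • Sk k + τ • S := by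
    have hSk (k : Fin K) : (Sk k)ᵀ = Sk k := (hX.posSemidef k).isHermitian
    have hS : Sᵀ = S := hS.isHermitian
    simp only [transpose_add, transpose_sum, transpose_smul, hSk, hS]
  have hlmi := posSemidef_fromBlocks_transpose_one_iff hsymm (B - Hᵀ * A)
  simp only [transpose_sub, transpose_mul, transpose_transpose, add_mulVec, dotProduct_add,
    quadForm_sum_smul, smul_mulVec, dotProduct_smul, smul_eq_mul] at hlmi
  have hbound : σ ^ 2 * (Hᵀ * H).trace + supportFn T lam ≤ τ ↔
      ∀ t ∈ T, σ ^ 2 * (Hᵀ * H).trace + lam ⬝ᵥ t ≤ τ := by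
    simp only [← le_sub_iff_add_le', hX.supportFn_le_iff]
  rw [← hlmi, ← hbound]
  exact ⟨fun h => ⟨h.lmi, h.bound, h.nonneg⟩, fun h => ⟨h.1, h.2.1, h.2.2⟩⟩

namespace DesignFeasible

theorem value_nonneg (hX : IsEllitopicData Sk T) (hS : S.PosSemidef)
    (h : DesignFeasible A B S σ Sk T τ H lam) : 0 ≤ τ := by
  obtain ⟨-, hbound, hlam⟩ := (designFeasible_iff hX hS).1 h
  obtain ⟨t, ht⟩ := hX.nonempty
  have hH := mul_nonneg (sq_nonneg σ) (trace_transpose_mul_self_nonneg H)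
  linarith [hbound t ht, hX.dotProduct_nonneg hlam ht]

theorem trace_le (hX : IsEllitopicData Sk T) (hS : S.PosSemidef) (hσ : σ ≠ 0)
    (h : DesignFeasible A B S σ Sk T τ H lam) : (Hᵀ * H).trace ≤ τ / σ ^ 2 := by
  obtain ⟨-, hbound, hlam⟩ := (designFeasible_iff hX hS).1 h
  obtain ⟨t, ht⟩ := hX.nonempty
  rw [le_div_iff₀' (by positivity)]
  linarith [hbound t ht, hX.dotProduct_nonneg hlam ht]

theorem lam_le (hX : IsEllitopicData Sk T) (hS : S.PosSemidef)
    (h : DesignFeasible A B S σ Sk T τ H lam) {t : Fin K → ℝ} (ht : t ∈ T) {k : Fin K}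
    (htk : 0 < t k) : lam k ≤ τ / t k := by
  obtain ⟨-, hbound, hlam⟩ := (designFeasible_iff hX hS).1 h
  have hH := mul_nonneg (sq_nonneg σ) (trace_transpose_mul_self_nonneg H)
  have hk : lam k * t k ≤ lam ⬝ᵥ t := Finset.single_le_sum (f := fun k => lam k * t k)
    (fun k _ => mul_nonneg (hlam k) (hX.nonneg t ht k)) (Finset.mem_univ k)
  rw [le_div_iff₀ htk]
  linarith [hbound t ht]

theorem value_pos (hX : IsEllitopicData Sk T) (hS : S.PosSemidef) (hσ : σ ≠ 0) (hB : B ≠ 0)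
    (h : DesignFeasible A B S σ Sk T τ H lam) : 0 < τ := by
  refine (h.value_nonneg hX hS).lt_of_ne' fun hτ => hB ?_
  subst hτ
  obtain ⟨t, ht, htpos⟩ := hX.meets_interior
  have hH : H = 0 := by
    have htr : (Hᵀ * H).trace = 0 :=
      le_antisymm (by simpa using h.trace_le hX hS hσ) (trace_transpose_mul_self_nonneg H)
    exact trace_conjTranspose_mul_self_eq_zero_iff.1 (by simpa using htr)
  have hlam (k : Fin K) : lam k = 0 :=
    le_antisymm (by simpa using h.lam_le hX hS ht (htpos k)) (h.nonneg k)
  have hBx (x : Fin N → ℝ) : (B *ᵥ x) ⬝ᵥ (B *ᵥ x) ≤ 0 := by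
    simpa [hH, hlam] using ((designFeasible_iff hX hS).1 h).1 x
  refine Matrix.ext_of_mulVec_single fun j => ?_
  rw [zero_mulVec]
  exact dotProduct_self_eq_zero.1 (le_antisymm (hBx _) (dotProduct_self_nonneg _))

end DesignFeasible

theorem exists_designFeasible_zero (A : Matrix (Fin m) (Fin N) ℝ) (B : Matrix (Fin ν) (Fin N) ℝ)
    (σ : ℝ) (hX : IsEllitopicData Sk T) (hS : S.PosSemidef) :
    ∃ (τ : ℝ) (lam : Fin K → ℝ), DesignFeasible A B S σ Sk T τ 0 lam := by
  obtain ⟨c, hc, hBc⟩ := exists_mulVec_dotProduct_self_le_quadForm hX.posDef_sum B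
  obtain ⟨r, hr, hsum⟩ := hX.exists_sum_le
  refine ⟨c * r, fun _ => c, (designFeasible_iff hX hS).2 ⟨fun x => ?_, fun t ht => ?_,
    fun _ => hc⟩⟩
  · have hSx := mul_nonneg (mul_nonneg hc hr.le) (quadForm_nonneg hS x)
    rw [transpose_zero, Matrix.zero_mul, sub_zero, ← Finset.mul_sum, ← quadForm_sum]
    linarith [hBc x]
  · simp only [dotProduct, ← Finset.mul_sum, Matrix.mul_zero, trace_zero, mul_zero, zero_add]
    exact mul_le_mul_of_nonneg_left (hsum t ht) hc

theorem isClosed_setOf_designFeasible (A : Matrix (Fin m) (Fin N) ℝ)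
    (B : Matrix (Fin ν) (Fin N) ℝ) (σ : ℝ) (hX : IsEllitopicData Sk T) (hS : S.PosSemidef) :
    IsClosed {p : ℝ × Matrix (Fin m) (Fin ν) ℝ × (Fin K → ℝ) |
      DesignFeasible A B S σ Sk T p.1 p.2.1 p.2.2} := by
  simp only [designFeasible_iff hX hS, Set.ofPred_and, Set.ofPred_forall]
  refine (isClosed_iInter fun x => isClosed_le ?_ ?_).inter
    ((isClosed_iInter fun t => isClosed_iInter fun _ => isClosed_le ?_ ?_).inter
      (isClosed_iInter fun k => isClosed_le ?_ ?_)) <;> fun_prop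

theorem isCompact_setOf_designFeasible_le (A : Matrix (Fin m) (Fin N) ℝ)
    (B : Matrix (Fin ν) (Fin N) ℝ) (hX : IsEllitopicData Sk T) (hS : S.PosSemidef) (hσ : σ ≠ 0)
    (τ₀ : ℝ) :
    IsCompact {p : ℝ × Matrix (Fin m) (Fin ν) ℝ × (Fin K → ℝ) |
      DesignFeasible A B S σ Sk T p.1 p.2.1 p.2.2 ∧ p.1 ≤ τ₀} := by
  obtain ⟨t, ht, htpos⟩ := hX.meets_interior
  have hbox : IsCompact (Set.Icc 0 τ₀ ×ˢ
      {H : Matrix (Fin m) (Fin ν) ℝ | (Hᵀ * H).trace ≤ τ₀ / σ ^ 2} ×ˢ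
        Set.Icc (0 : Fin K → ℝ) fun k => τ₀ / t k) :=
    isCompact_Icc.prod ((isCompact_setOf_trace_transpose_mul_self_le _).prod isCompact_Icc)
  refine hbox.of_isClosed_subset ((isClosed_setOf_designFeasible A B σ hX hS).inter
    (isClosed_le continuous_fst continuous_const)) ?_
  rintro ⟨τ, H, lam⟩ ⟨hfeas, hle : τ ≤ τ₀⟩
  refine ⟨⟨hfeas.value_nonneg hX hS, hle⟩, (hfeas.trace_le hX hS hσ).trans (by gcongr),
    hfeas.nonneg, fun k => (hfeas.lam_le hX hS ht (htpos k)).trans ?_⟩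
  exact div_le_div_of_nonneg_right hle (htpos k).le

theorem exists_designOptimal (A : Matrix (Fin m) (Fin N) ℝ) (B : Matrix (Fin ν) (Fin N) ℝ)
    (hX : IsEllitopicData Sk T) (hS : S.PosSemidef) (hσ : σ ≠ 0) :
    ∃ (τ : ℝ) (H : Matrix (Fin m) (Fin ν) ℝ) (lam : Fin K → ℝ),
      DesignOptimal A B S σ Sk T τ H lam := by
  obtain ⟨τ₀, lam₀, h₀⟩ := exists_designFeasible_zero A B σ hX hS
  obtain ⟨⟨τ, H, lam⟩, ⟨hfeas, hle⟩, hmin⟩ :=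
    (isCompact_setOf_designFeasible_le A B hX hS hσ τ₀).exists_isMinOn ⟨(τ₀, 0, lam₀), h₀, le_rfl⟩
      continuous_fst.continuousOn
  refine ⟨τ, H, lam, hfeas, fun τ' H' lam' h' => ?_⟩
  rcases le_total τ' τ₀ with hτ' | hτ'
  · exact hmin (a := (τ', H', lam')) ⟨h', hτ'⟩
  · exact hle.trans hτ'

end DesignProgram

section Duality

theorem exists_forall_nonneg_of_forall_exists {E F : Type*}
    [TopologicalSpace E] [AddCommGroup E] [Module ℝ E] [IsTopologicalAddGroup E]
    [ContinuousSMul ℝ E] [TopologicalSpace F] [AddCommGroup F] [Module ℝ F]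
    [IsTopologicalAddGroup F] [ContinuousSMul ℝ F] {X : Set E} {Y : Set F} {g : E → F → ℝ}
    (hne : X.Nonempty) (hXc : IsCompact X) (hX : Convex ℝ X) (hY : Convex ℝ Y)
    (hgx : ∀ y ∈ Y, Continuous fun x => g x y) (hgx' : ∀ y ∈ Y, ConcaveOn ℝ X fun x => g x y)
    (hgy : ∀ x ∈ X, Continuous fun y => g x y) (hgy' : ∀ x ∈ X, ConvexOn ℝ Y fun y => g x y)
    (h : ∀ y ∈ Y, ∃ x ∈ X, 0 ≤ g x y) : ∃ x ∈ X, ∀ y ∈ Y, 0 ≤ g x y := by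
  by_contra! hcon
  obtain ⟨s, hs, hsf, hcov⟩ := hXc.elim_finite_subcover_image (b := Y)
    (c := fun y => {x | g x y < 0}) (fun y hy => isOpen_lt (hgx y hy) continuous_const)
    (fun x hx => Set.mem_iUnion₂.2 ((hcon x hx).imp fun _ h => ⟨h.1, h.2⟩))
  obtain ⟨y, hy, hpos⟩ := Sion.exists_lt_iInf_of_lt_iInf_of_finite (f := fun x y => -g x y)
    hne hXc (fun y hy => ((hgx y hy).neg.lowerSemicontinuous).lowerSemicontinuousOn _)
    (fun y hy => (hgx' y hy).neg.quasiconvexOn) hY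
    (fun x hx => ((hgy x hx).neg.upperSemicontinuous).upperSemicontinuousOn _)
    (fun x hx => (hgy' x hx).neg.quasiconcaveOn) hX hsf hs (t := 0)
    (fun x hx => by simpa using hcov hx)
  obtain ⟨x, hx, hxy⟩ := h y hy
  exact (neg_pos.1 (hpos x hx)).not_ge hxy

variable {N m ν K : ℕ} {A : Matrix (Fin m) (Fin N) ℝ} {B : Matrix (Fin ν) (Fin N) ℝ}
  {S : Matrix (Fin N) (Fin N) ℝ} {σ τ r : ℝ} {Sk : Fin K → Matrix (Fin N) (Fin N) ℝ}
  {T : Set (Fin K → ℝ)} {Q : Matrix (Fin N) (Fin N) ℝ}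

/-- The Bayes risk `E ‖Hᵀ(A η + σ ξ) - B η‖²` of the linear estimate `Hᵀ ω` under the prior
`η ∼ 𝒩(0, Q)`. -/
def linearCost (A : Matrix (Fin m) (Fin N) ℝ) (B : Matrix (Fin ν) (Fin N) ℝ) (σ : ℝ)
    (Q : Matrix (Fin N) (Fin N) ℝ) (H : Matrix (Fin m) (Fin ν) ℝ) : ℝ :=
  ((B - Hᵀ * A) * Q * (B - Hᵀ * A)ᵀ).trace + σ ^ 2 * (Hᵀ * H).trace

theorem linearCost_convex (hQ : Q.PosSemidef) (H₁ H₂ : Matrix (Fin m) (Fin ν) ℝ) {a b : ℝ}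
    (ha : 0 ≤ a) (hb : 0 ≤ b) (hab : a + b = 1) :
    linearCost A B σ Q (a • H₁ + b • H₂) ≤
      a * linearCost A B σ Q H₁ + b * linearCost A B σ Q H₂ := by
  have hbias : B - (a • H₁ + b • H₂)ᵀ * A = a • (B - H₁ᵀ * A) + b • (B - H₂ᵀ * A) := by
    obtain rfl : b = 1 - a := by linarith
    simp only [transpose_add, transpose_smul, Matrix.add_mul, smul_mul]
    module
  have hquad := trace_mul_mul_transpose_convex hQ (B - H₁ᵀ * A) (B - H₂ᵀ * A) ha hb hab
  have hnoise := trace_mul_mul_transpose_convex (PosSemidef.one (n := Fin m) (R := ℝ))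
    H₁ᵀ H₂ᵀ ha hb hab
  simp only [Matrix.mul_one, ← transpose_smul, ← transpose_add, transpose_transpose] at hnoise
  rw [linearCost, linearCost, linearCost, hbias]
  linarith [mul_le_mul_of_nonneg_left hnoise (sq_nonneg σ)]

theorem mul_linearCost_le_linearCost_smul (Q : Matrix (Fin N) (Fin N) ℝ)
    (H : Matrix (Fin m) (Fin ν) ℝ) {δ : ℝ} (hδ : δ ≤ 1) :
    δ * linearCost A B σ Q H ≤ linearCost A B σ (δ • Q) H := by
  have h := mul_nonneg (sub_nonneg.2 hδ)
    (mul_nonneg (sq_nonneg σ) (trace_transpose_mul_self_nonneg H))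
  simp only [linearCost, Matrix.mul_smul, smul_mul, trace_smul, smul_eq_mul]
  linarith

/-- The Lagrangian of the design program at value `τ`. The dual variables are `p = (Q, t)`, the
primal ones `q = (H, λ)`. -/
def lagrangian (A : Matrix (Fin m) (Fin N) ℝ) (B : Matrix (Fin ν) (Fin N) ℝ)
    (S : Matrix (Fin N) (Fin N) ℝ) (σ : ℝ) (Sk : Fin K → Matrix (Fin N) (Fin N) ℝ) (τ : ℝ)
    (p : Matrix (Fin N) (Fin N) ℝ × (Fin K → ℝ)) (q : Matrix (Fin m) (Fin ν) ℝ × (Fin K → ℝ)) :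
    ℝ :=
  linearCost A B σ p.1 q.1 - τ * (1 + (p.1 * S).trace) +
    q.2 ⬝ᵥ (p.2 - fun k => (p.1 * Sk k).trace)

theorem lagrangian_eq_trace_mul_add (p : Matrix (Fin N) (Fin N) ℝ × (Fin K → ℝ))
    (q : Matrix (Fin m) (Fin ν) ℝ × (Fin K → ℝ)) :
    lagrangian A B S σ Sk τ p q =
      (p.1 * ((B - q.1ᵀ * A)ᵀ * (B - q.1ᵀ * A) - τ • S - ∑ k, q.2 k • Sk k)).trace +
        q.2 ⬝ᵥ p.2 + (σ ^ 2 * (q.1ᵀ * q.1).trace - τ) := by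
  have hlin : q.2 ⬝ᵥ (fun k => (p.1 * Sk k).trace) = (p.1 * ∑ k, q.2 k • Sk k).trace := by
    simp only [dotProduct, Finset.mul_sum, Matrix.mul_smul, trace_sum, trace_smul, smul_eq_mul]
  rw [lagrangian, linearCost]
  generalize B - q.1ᵀ * A = E
  rw [trace_mul_cycle, trace_mul_comm, dotProduct_sub, hlin, Matrix.mul_sub, Matrix.mul_sub,
    Matrix.mul_smul, trace_sub, trace_sub, trace_smul, smul_eq_mul]
  ring

theorem concaveOn_lagrangian {X : Set (Matrix (Fin N) (Fin N) ℝ × (Fin K → ℝ))}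
    (hX : Convex ℝ X) (q : Matrix (Fin m) (Fin ν) ℝ × (Fin K → ℝ)) :
    ConcaveOn ℝ X fun p => lagrangian A B S σ Sk τ p q := by
  refine ⟨hX, fun x _ y _ a b _ _ hab => le_of_eq ?_⟩
  obtain rfl : b = 1 - a := by linarith
  simp only [lagrangian_eq_trace_mul_add, Prod.fst_add, Prod.snd_add, Prod.smul_fst,
    Prod.smul_snd, Matrix.add_mul, smul_mul, trace_add, trace_smul, dotProduct_add, dotProduct_smul,
    smul_eq_mul]
  ring

theorem convexOn_lagrangian {Y : Set (Matrix (Fin m) (Fin ν) ℝ × (Fin K → ℝ))}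
    (hY : Convex ℝ Y) {p : Matrix (Fin N) (Fin N) ℝ × (Fin K → ℝ)} (hp : p.1.PosSemidef) :
    ConvexOn ℝ Y (lagrangian A B S σ Sk τ p) := by
  refine ⟨hY, fun x _ y _ a b ha hb hab => ?_⟩
  have h := linearCost_convex (A := A) (B := B) (σ := σ) hp x.1 y.1 ha hb hab
  obtain rfl : b = 1 - a := by linarith
  simp only [lagrangian, Prod.fst_add, Prod.snd_add, Prod.smul_fst, Prod.smul_snd, add_dotProduct,
    smul_dotProduct, smul_eq_mul]
  linarith

/-- The multiplier `μ` of the constraint `Tr(Q ∑ S_k) ≤ r` is absorbed into `λ`: adding `μ` to every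
`λ_k` costs at most `μ r` in the support function. -/
theorem exists_designFeasible_of_lagrangian_nonpos (hX : IsEllitopicData Sk T)
    (hS : S.PosSemidef) (hr : 0 < r) (hsum : ∀ t ∈ T, ∑ k, t k ≤ r)
    {q : Matrix (Fin m) (Fin ν) ℝ × (Fin K → ℝ)} (hlam : ∀ k, 0 ≤ q.2 k)
    (h : ∀ p ∈ psdSection (∑ k, Sk k) r ×ˢ T, lagrangian A B S σ Sk τ p q ≤ 0) :
    ∃ lam, DesignFeasible A B S σ Sk T τ q.1 lam := by
  obtain ⟨H, lam⟩ := q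
  set E := B - Hᵀ * A with hE
  obtain ⟨t₁, ht₁, htmax⟩ := hX.isCompact.exists_isMaxOn hX.nonempty
    (f := fun t => lam ⬝ᵥ t) (by fun_prop)
  obtain ⟨μ, hμ⟩ : ∃ μ, r * μ = τ - σ ^ 2 * (Hᵀ * H).trace - lam ⬝ᵥ t₁ :=
    ⟨_, mul_div_cancel₀ _ hr.ne'⟩
  have hW (Q : Matrix (Fin N) (Fin N) ℝ) (hQ : Q ∈ psdSection (∑ k, Sk k) r) :
      (Q * (Eᵀ * E - τ • S - ∑ k, lam k • Sk k)).trace ≤ r * μ := by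
    have := h (Q, t₁) ⟨hQ, ht₁⟩
    rw [lagrangian_eq_trace_mul_add, ← hE] at this
    linarith
  have hμ0 : 0 ≤ μ := by
    have := hW 0 (zero_mem_psdSection hr.le)
    rw [Matrix.zero_mul, trace_zero] at this
    exact nonneg_of_mul_nonneg_right this hr
  refine ⟨fun k => lam k + μ, (designFeasible_iff hX hS).2 ⟨fun x => ?_, fun t ht => ?_,
    fun k => add_nonneg (hlam k) hμ0⟩⟩
  · have hx := quadForm_le_of_forall_mem_psdSection hX.posDef_sum hr hW x
    simp only [sub_mulVec, dotProduct_sub, smul_mulVec, dotProduct_smul, smul_eq_mul,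
      quadForm_sum, ← mulVec_dotProduct_mulVec_self] at hx
    simp only [add_mul, Finset.sum_add_distrib, ← Finset.mul_sum]
    linarith
  · have hmax : lam ⬝ᵥ t ≤ lam ⬝ᵥ t₁ := htmax ht
    have hadd : (fun k => lam k + μ) ⬝ᵥ t = lam ⬝ᵥ t + μ * ∑ k, t k := by
      simp only [dotProduct, add_mul, Finset.sum_add_distrib, Finset.mul_sum]
    linarith [mul_le_mul_of_nonneg_left (hsum t ht) hμ0]

theorem forall_trace_le_of_lagrangian_nonneg {t : Fin K → ℝ}
    (h : ∀ q : Matrix (Fin m) (Fin ν) ℝ × (Fin K → ℝ), (∀ k, 0 ≤ q.2 k) →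
      0 ≤ lagrangian A B S σ Sk τ (Q, t) q) (k : Fin K) : (Q * Sk k).trace ≤ t k := by
  by_contra! hlt
  set c := linearCost A B σ Q (0 : Matrix (Fin m) (Fin ν) ℝ) - τ * (1 + (Q * S).trace)
  set d := (Q * Sk k).trace - t k with hd
  have hd0 : 0 < d := sub_pos.2 hlt
  have hnonneg : 0 ≤ (Pi.single k ((|c| + 1) / d) : Fin K → ℝ) :=
    Pi.single_nonneg.2 (by positivity)
  have hval := h (0, Pi.single k ((|c| + 1) / d)) hnonneg
  have hmul : (|c| + 1) / d * (t k - (Q * Sk k).trace) = -(|c| + 1) := by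
    rw [← neg_sub, ← hd, mul_neg, div_mul_cancel₀ _ hd0.ne']
  rw [lagrangian, single_dotProduct, Pi.sub_apply, hmul] at hval
  linarith [le_abs_self c]

theorem exists_leastFavorable (hX : IsEllitopicData Sk T) (hS : S.PosSemidef)
    (h : ∀ (H : Matrix (Fin m) (Fin ν) ℝ) lam, ¬DesignFeasible A B S σ Sk T τ H lam) :
    ∃ Q : Matrix (Fin N) (Fin N) ℝ, Q.PosSemidef ∧ (∃ t ∈ T, ∀ k, (Q * Sk k).trace ≤ t k) ∧
      ∀ H : Matrix (Fin m) (Fin ν) ℝ, τ * (1 + (Q * S).trace) ≤ linearCost A B σ Q H := by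
  obtain ⟨r, hr, hsum⟩ := hX.exists_sum_le
  obtain ⟨t₀, ht₀⟩ := hX.nonempty
  have hconvex := (convex_psdSection (∑ k, Sk k) r).prod hX.convex
  have hconvex' : Convex ℝ {q : Matrix (Fin m) (Fin ν) ℝ × (Fin K → ℝ) | ∀ k, 0 ≤ q.2 k} :=
    fun x hx y hy a b ha hb _ k => add_nonneg (mul_nonneg ha (hx k)) (mul_nonneg hb (hy k))
  obtain ⟨⟨Q, t⟩, ⟨⟨hQ, -⟩, ht⟩, hnonneg⟩ := exists_forall_nonneg_of_forall_exists
    (X := psdSection (∑ k, Sk k) r ×ˢ T) (g := lagrangian A B S σ Sk τ)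
    ⟨(0, t₀), zero_mem_psdSection hr.le, ht₀⟩
    ((isCompact_psdSection hX.posDef_sum r).prod hX.isCompact) hconvex hconvex'
    (fun q _ => by unfold lagrangian linearCost; fun_prop)
    (fun q _ => concaveOn_lagrangian hconvex q)
    (fun p _ => by unfold lagrangian linearCost; fun_prop)
    (fun p hp => convexOn_lagrangian hconvex' hp.1.1) (by
      by_contra! hneg
      obtain ⟨q, hlam, hq⟩ := hneg
      obtain ⟨lam, hfeas⟩ := exists_designFeasible_of_lagrangian_nonpos hX hS hr hsum hlam
        fun p hp => (hq p hp).le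
      exact h q.1 lam hfeas)
  refine ⟨Q, hQ, ⟨t, ht, forall_trace_le_of_lagrangian_nonneg hnonneg⟩, fun H => ?_⟩
  simpa [lagrangian] using hnonneg (H, 0) fun _ => le_rfl

end Duality

section Gaussian

variable {n p : ℕ}

instance isGaussian_stdNormal (n : ℕ) : IsGaussian (stdNormal n) := by
  rw [← isGaussian_map_equiv_iff (EuclideanSpace.equiv (Fin n) ℝ).symm]
  change IsGaussian ((Measure.pi fun _ => gaussianReal 0 1).map (WithLp.toLp 2))
  rw [map_pi_eq_stdGaussian]
  infer_instance

theorem memLp_dotProduct_stdNormal (a : Fin n → ℝ) :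
    MemLp (fun x => a ⬝ᵥ x) 2 (stdNormal n) :=
  IsGaussian.memLp_dual (stdNormal n) (dotProductBilin ℝ ℝ a).toContinuousLinearMap 2 (by simp)

theorem memLp_eval_stdNormal (i : Fin n) : MemLp (fun x => x i) 2 (stdNormal n) := by
  simpa using memLp_dotProduct_stdNormal (Pi.single i 1)

theorem integral_dotProduct_stdNormal (a : Fin n → ℝ) : ∫ x, a ⬝ᵥ x ∂(stdNormal n) = 0 := by
  have heval (i : Fin n) : ∫ x, x i ∂(stdNormal n) = 0 :=
    (integral_comp_eval (μ := fun _ : Fin n => gaussianReal 0 1) (i := i)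
      (f := fun x : ℝ => x) (by fun_prop)).trans integral_id_gaussianReal
  simp only [dotProduct]
  rw [integral_finsetSum _ fun i _ => ((memLp_eval_stdNormal i).integrable one_le_two).const_mul _]
  simp only [integral_const_mul, heval, mul_zero, Finset.sum_const_zero]

theorem covariance_eval_stdNormal (i j : Fin n) :
    cov[fun x => x i, fun x => x j; stdNormal n] = if i = j then 1 else 0 := by
  split_ifs with hij
  · subst hij
    rw [covariance_self (memLp_eval_stdNormal i).aemeasurable]
    exact ((measurePreserving_eval (fun _ : Fin n => gaussianReal 0 1) i).variance_fun_comp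
      aemeasurable_id).trans (by simp)
  · have hindep : iIndepFun (fun i x => x i) (stdNormal n) :=
      iIndepFun_pi (X := fun _ x => x) fun _ => aemeasurable_id
    exact (hindep.indepFun hij).covariance_eq_zero (memLp_eval_stdNormal i) (memLp_eval_stdNormal j)

theorem covariance_dotProduct_stdNormal (a b : Fin n → ℝ) :
    cov[fun x => a ⬝ᵥ x, fun x => b ⬝ᵥ x; stdNormal n] = a ⬝ᵥ b := by
  simp only [dotProduct]
  rw [covariance_fun_sum_fun_sum (fun i => (memLp_eval_stdNormal i).const_mul _)
    (fun i => (memLp_eval_stdNormal i).const_mul _)]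
  simp only [covariance_const_mul_left, covariance_const_mul_right, covariance_eval_stdNormal,
    mul_ite, mul_one, mul_zero, Finset.sum_ite_eq, Finset.mem_univ, if_true]
  exact dotProduct_comm b a

theorem map_dotProduct_stdNormal (a : Fin n → ℝ) :
    (stdNormal n).map (fun x => a ⬝ᵥ x) = gaussianReal 0 (a ⬝ᵥ a).toNNReal := by
  have h := IsGaussian.map_eq_gaussianReal (μ := stdNormal n)
    (dotProductBilin ℝ ℝ a).toContinuousLinearMap
  change (stdNormal n).map (fun x => a ⬝ᵥ x) = gaussianReal (∫ x, a ⬝ᵥ x ∂(stdNormal n))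
    (Var[fun x => a ⬝ᵥ x; stdNormal n]).toNNReal at h
  rw [h, integral_dotProduct_stdNormal, ← covariance_self
    (memLp_dotProduct_stdNormal a).aemeasurable, covariance_dotProduct_stdNormal]

theorem lintegral_sq_gaussianReal (v : NNReal) :
    ∫⁻ x, ENNReal.ofReal (x ^ 2) ∂(gaussianReal 0 v) = v := by
  have hvar := variance_of_integral_eq_zero (μ := gaussianReal 0 v) (X := fun x => x)
    (by fun_prop) integral_id_gaussianReal
  rw [variance_fun_id_gaussianReal] at hvar
  have hint : Integrable (fun x => x ^ 2) (gaussianReal 0 v) :=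
    (memLp_id_gaussianReal 2).integrable_sq
  rw [← ofReal_integral_eq_lintegral_ofReal hint (ae_of_all _ fun x => sq_nonneg x), ← hvar,
    ENNReal.ofReal_coe_nnreal]

theorem lintegral_sq_add_dotProduct_stdNormal (c : ℝ) (b : Fin n → ℝ) :
    ∫⁻ x, ENNReal.ofReal ((c + b ⬝ᵥ x) ^ 2) ∂(stdNormal n) = ENNReal.ofReal (c ^ 2 + b ⬝ᵥ b) := by
  have hb := memLp_dotProduct_stdNormal b
  have hcb : MemLp (fun x => c + b ⬝ᵥ x) 2 (stdNormal n) := (memLp_const c).add hb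
  have hvar : Var[fun x => c + b ⬝ᵥ x; stdNormal n] = b ⬝ᵥ b := by
    rw [variance_const_add hb.aestronglyMeasurable, ← covariance_self hb.aemeasurable,
      covariance_dotProduct_stdNormal]
  have hmean : ∫ x, (c + b ⬝ᵥ x) ∂(stdNormal n) = c := by
    rw [integral_add (integrable_const c) (hb.integrable one_le_two),
      integral_dotProduct_stdNormal]
    simp
  have hsq := variance_eq_sub hcb
  rw [hvar, hmean, eq_sub_iff_add_eq'] at hsq
  rw [← ofReal_integral_eq_lintegral_ofReal hcb.integrable_sq (ae_of_all _ fun x => sq_nonneg _),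
    hsq]
  rfl

theorem lintegral_mulVec_dotProduct_self_stdNormal (D : Matrix (Fin p) (Fin n) ℝ) :
    ∫⁻ x, ENNReal.ofReal ((D *ᵥ x) ⬝ᵥ (D *ᵥ x)) ∂(stdNormal n) =
      ENNReal.ofReal (D * Dᵀ).trace := by
  have h (x : Fin n → ℝ) : ENNReal.ofReal ((D *ᵥ x) ⬝ᵥ (D *ᵥ x)) =
      ∑ i, ENNReal.ofReal ((D i ⬝ᵥ x) ^ 2) := by
    rw [← ENNReal.ofReal_sum_of_nonneg fun _ _ => sq_nonneg _]
    simp only [dotProduct, mulVec, sq]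
  simp only [h]
  rw [lintegral_finsetSum _ fun i _ => by fun_prop, trace_mul_transpose_self,
    ENNReal.ofReal_sum_of_nonneg fun i _ => dotProduct_self_nonneg (D i)]
  exact Finset.sum_congr rfl fun i _ => by
    simpa using lintegral_sq_add_dotProduct_stdNormal 0 (D i)

end Gaussian

section GaussianTail

variable {n p q : ℕ}

theorem gaussianPDFReal_mul_exp (x : ℝ) :
    gaussianPDFReal 0 1 x * Real.exp (x ^ 2 / 3) = √3 * gaussianPDFReal 0 3 x := by
  have hexp : -x ^ 2 / 2 + x ^ 2 / 3 = -x ^ 2 / (2 * 3) := by ring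
  simp only [gaussianPDFReal, sub_zero, NNReal.coe_one, mul_one, NNReal.coe_ofNat]
  rw [mul_assoc, ← Real.exp_add, hexp, Real.sqrt_mul (by positivity) 3, mul_inv]
  field_simp

theorem lintegral_mul_exp_gaussianReal {f : ℝ → ℝ} (hf : Measurable f) :
    ∫⁻ x, ENNReal.ofReal (f x * Real.exp (x ^ 2 / 3)) ∂(gaussianReal 0 1) =
      ENNReal.ofReal √3 * ∫⁻ x, ENNReal.ofReal (f x) ∂(gaussianReal 0 3) := by
  rw [gaussianReal_of_var_ne_zero _ one_ne_zero, gaussianReal_of_var_ne_zero _ three_ne_zero,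
    lintegral_withDensity_eq_lintegral_mul _ (by fun_prop) (by fun_prop),
    lintegral_withDensity_eq_lintegral_mul _ (by fun_prop) (by fun_prop),
    ← lintegral_const_mul _ (by fun_prop)]
  refine lintegral_congr fun x => ?_
  have h := gaussianPDFReal_mul_exp x
  simp only [Pi.mul_apply, gaussianPDF]
  rw [← ENNReal.ofReal_mul (gaussianPDFReal_nonneg _ _ _),
    ← ENNReal.ofReal_mul (gaussianPDFReal_nonneg _ _ _), ← ENNReal.ofReal_mul (by positivity)]
  congr 1
  linear_combination f x * h

/-- The normalized linear functional `x ↦ (a ⬝ᵥ x) / ‖a‖₂`, a standard normal variable under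
`stdNormal` unless `a = 0`, when it is the junk value `0`. -/
noncomputable def unitFunctional (a x : Fin n → ℝ) : ℝ := (a ⬝ᵥ x) / √(a ⬝ᵥ a)

@[fun_prop]
theorem measurable_unitFunctional (a : Fin n → ℝ) : Measurable (unitFunctional a) := by
  unfold unitFunctional
  fun_prop

theorem mul_sq_unitFunctional (a x : Fin n → ℝ) :
    (a ⬝ᵥ a) * unitFunctional a x ^ 2 = (a ⬝ᵥ x) ^ 2 := by
  rcases eq_or_ne a 0 with rfl | ha
  · simp
  have hpos := dotProduct_self_pos ha
  rw [unitFunctional, div_pow, Real.sq_sqrt hpos.le]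
  field_simp

theorem map_unitFunctional {a : Fin n → ℝ} (ha : a ≠ 0) :
    (stdNormal n).map (unitFunctional a) = gaussianReal 0 1 := by
  have hpos := dotProduct_self_pos ha
  have h : unitFunctional a = fun x => ((√(a ⬝ᵥ a))⁻¹ • a) ⬝ᵥ x := by
    ext x
    rw [unitFunctional, smul_dotProduct, smul_eq_mul, div_eq_inv_mul]
  rw [h, map_dotProduct_stdNormal]
  congr
  rw [smul_dotProduct, dotProduct_smul, smul_eq_mul, smul_eq_mul, ← mul_assoc, ← mul_inv,
    Real.mul_self_sqrt hpos.le, inv_mul_cancel₀ hpos.ne', Real.toNNReal_one]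

theorem lintegral_unitFunctional_mul_exp {f : ℝ → ℝ} (hf : Measurable f) {a : Fin n → ℝ}
    (ha : a ≠ 0) :
    ∫⁻ x, ENNReal.ofReal (f (unitFunctional a x) * Real.exp (unitFunctional a x ^ 2 / 3))
        ∂(stdNormal n) =
      ENNReal.ofReal √3 * ∫⁻ x, ENNReal.ofReal (f x) ∂(gaussianReal 0 3) := by
  rw [← lintegral_mul_exp_gaussianReal hf, ← map_unitFunctional ha,
    lintegral_map (by fun_prop) (by fun_prop)]

theorem lintegral_exp_unitFunctional_le (a : Fin n → ℝ) :
    ∫⁻ x, ENNReal.ofReal (Real.exp (unitFunctional a x ^ 2 / 3)) ∂(stdNormal n) ≤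
      ENNReal.ofReal √3 := by
  rcases eq_or_ne a 0 with rfl | ha
  · simp [unitFunctional]
  · have h := lintegral_unitFunctional_mul_exp (f := fun _ => 1) measurable_const ha
    simpa using h.le

theorem lintegral_sq_mul_exp_unitFunctional_le (a : Fin n → ℝ) :
    ∫⁻ x, ENNReal.ofReal (unitFunctional a x ^ 2 * Real.exp (unitFunctional a x ^ 2 / 3))
      ∂(stdNormal n) ≤ ENNReal.ofReal (3 * √3) := by
  rcases eq_or_ne a 0 with rfl | ha
  · simp [unitFunctional]
  · rw [lintegral_unitFunctional_mul_exp (f := fun x => x ^ 2) (by fun_prop) ha,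
      lintegral_sq_gaussianReal, mul_comm 3, ENNReal.ofReal_mul (by positivity)]
    simp

theorem mul_exp_le_add {a b : ℝ} (ha : 0 ≤ a) (hb : 0 ≤ b) :
    a * Real.exp (b / 3) ≤ a * Real.exp (a / 3) + b * Real.exp (b / 3) := by
  rcases le_total a b with h | h
  · calc a * Real.exp (b / 3) ≤ b * Real.exp (b / 3) := by gcongr
      _ ≤ _ := le_add_of_nonneg_left (by positivity)
  · calc a * Real.exp (b / 3) ≤ a * Real.exp (a / 3) := by gcongr
      _ ≤ _ := le_add_of_nonneg_right (by positivity)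

theorem mulVec_dotProduct_self_eq_sum (D : Matrix (Fin p) (Fin n) ℝ) (x : Fin n → ℝ) :
    (D *ᵥ x) ⬝ᵥ (D *ᵥ x) = ∑ i, (D i ⬝ᵥ D i) * unitFunctional (D i) x ^ 2 := by
  refine Finset.sum_congr rfl fun i _ => ?_
  rw [mul_sq_unitFunctional, sq]
  rfl

theorem add_mul_mul_exp_le (F : Matrix (Fin q) (Fin n) ℝ) (v x : Fin n → ℝ) {a c : ℝ}
    (hc : 0 ≤ c) :
    (a + c * ((F *ᵥ x) ⬝ᵥ (F *ᵥ x))) * Real.exp (unitFunctional v x ^ 2 / 3) ≤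
      a * Real.exp (unitFunctional v x ^ 2 / 3) + ∑ j, c * (F j ⬝ᵥ F j) *
        (unitFunctional (F j) x ^ 2 * Real.exp (unitFunctional (F j) x ^ 2 / 3) +
          unitFunctional v x ^ 2 * Real.exp (unitFunctional v x ^ 2 / 3)) := by
  rw [add_mul, mulVec_dotProduct_self_eq_sum, Finset.mul_sum, Finset.sum_mul]
  refine add_le_add le_rfl (Finset.sum_le_sum fun j _ => ?_)
  rw [← mul_assoc, mul_assoc (c * _)]
  exact mul_le_mul_of_nonneg_left (mul_exp_le_add (sq_nonneg _) (sq_nonneg _))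
    (mul_nonneg hc (dotProduct_self_nonneg _))

theorem lintegral_add_mul_mul_exp_le (F : Matrix (Fin q) (Fin n) ℝ) (v : Fin n → ℝ) {a c : ℝ}
    (ha : 0 ≤ a) (hc : 0 ≤ c) :
    ∫⁻ x, ENNReal.ofReal ((a + c * ((F *ᵥ x) ⬝ᵥ (F *ᵥ x))) *
        Real.exp (unitFunctional v x ^ 2 / 3)) ∂(stdNormal n) ≤
      ENNReal.ofReal (√3 * (a + 6 * c * (F * Fᵀ).trace)) := by
  let E (x : Fin n → ℝ) := ENNReal.ofReal (Real.exp (unitFunctional v x ^ 2 / 3))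
  let G (u x : Fin n → ℝ) :=
    ENNReal.ofReal (unitFunctional u x ^ 2 * Real.exp (unitFunctional u x ^ 2 / 3))
  have hG (u : Fin n → ℝ) : Measurable (G u) := by fun_prop
  have hF (j : Fin q) : 0 ≤ c * (F j ⬝ᵥ F j) := mul_nonneg hc (dotProduct_self_nonneg _)
  calc _ ≤ ∫⁻ x, (ENNReal.ofReal a * E x +
        ∑ j, ENNReal.ofReal (c * (F j ⬝ᵥ F j)) * (G (F j) x + G v x)) ∂(stdNormal n) := by
        refine lintegral_mono fun x => (ENNReal.ofReal_le_ofReal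
          (add_mul_mul_exp_le F v x hc)).trans (ENNReal.ofReal_add_le.trans ?_)
        rw [ENNReal.ofReal_mul ha, ENNReal.ofReal_sum_of_nonneg fun j _ =>
          mul_nonneg (hF j) (by positivity)]
        gcongr with j
        rw [ENNReal.ofReal_mul (hF j), ENNReal.ofReal_add (by positivity) (by positivity)]
    _ = ENNReal.ofReal a * ∫⁻ x, E x ∂(stdNormal n) + ∑ j, ENNReal.ofReal (c * (F j ⬝ᵥ F j)) *
        (∫⁻ x, G (F j) x ∂(stdNormal n) + ∫⁻ x, G v x ∂(stdNormal n)) := by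
        rw [lintegral_add_left (by fun_prop), lintegral_const_mul _ (by fun_prop),
          lintegral_finsetSum _ fun j _ => by fun_prop]
        congr! with j
        rw [lintegral_const_mul _ (by fun_prop), lintegral_add_left (hG _)]
    _ ≤ ENNReal.ofReal a * ENNReal.ofReal √3 + ∑ j, ENNReal.ofReal (c * (F j ⬝ᵥ F j)) *
        (ENNReal.ofReal (3 * √3) + ENNReal.ofReal (3 * √3)) := by
        gcongr
        exacts [lintegral_exp_unitFunctional_le v, lintegral_sq_mul_exp_unitFunctional_le _,
          lintegral_sq_mul_exp_unitFunctional_le v]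
    _ = ENNReal.ofReal (√3 * (a + 6 * c * (F * Fᵀ).trace)) := by
        rw [← Finset.sum_mul, ← ENNReal.ofReal_sum_of_nonneg fun j _ => hF j, ← Finset.mul_sum,
          ← trace_mul_transpose_self, ← ENNReal.ofReal_add (by positivity) (by positivity),
          ← ENNReal.ofReal_mul ha, ← ENNReal.ofReal_mul
            (mul_nonneg hc (trace_mul_transpose_self_nonneg F)),
          ← ENNReal.ofReal_add (by positivity)
            (mul_nonneg (mul_nonneg hc (trace_mul_transpose_self_nonneg F)) (by positivity))]
        congr 1
        ring

/-- Jensen's inequality for `exp` with the weights `‖D i‖² / Tr(D Dᵀ)`: on the tail event the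
weighted mean of the exponents `unitFunctional (D i) x ^ 2 / 3` is at least `1 / (3 δ)`. -/
theorem one_le_exp_mul_sum_exp (D : Matrix (Fin p) (Fin n) ℝ) {t δ : ℝ} (hδ : 0 < δ)
    (ht : (D * Dᵀ).trace ≤ δ * t) {x : Fin n → ℝ} (hx : t < (D *ᵥ x) ⬝ᵥ (D *ᵥ x)) :
    1 ≤ Real.exp (-(1 / (3 * δ))) * ∑ i, (D i ⬝ᵥ D i) / (D * Dᵀ).trace *
      Real.exp (unitFunctional (D i) x ^ 2 / 3) := by
  have hle := mulVec_dotProduct_self_le D x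
  have hquad := mulVec_dotProduct_self_eq_sum D x
  have hsum := trace_mul_transpose_self D
  have hs0 := trace_mul_transpose_self_nonneg D
  set s := (D * Dᵀ).trace
  have hs : 0 < s := by
    refine hs0.lt_of_ne fun h0 => ?_
    rw [← h0, zero_mul] at hle
    nlinarith
  have hjensen := convexOn_exp.map_sum_le (t := Finset.univ) (w := fun i => (D i ⬝ᵥ D i) / s)
    (p := fun i => unitFunctional (D i) x ^ 2 / 3)
    (fun i _ => div_nonneg (dotProduct_self_nonneg _) hs0)
    (by rw [← Finset.sum_div, ← hsum, div_self hs.ne']) (fun i _ => Set.mem_univ _)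
  have hmean : 1 / (3 * δ) ≤ ∑ i, ((D i ⬝ᵥ D i) / s) • (unitFunctional (D i) x ^ 2 / 3) :=
    calc 1 / (3 * δ) ≤ ((D *ᵥ x) ⬝ᵥ (D *ᵥ x)) / (s * 3) := by
          rw [div_le_div_iff₀ (by positivity) (by positivity)]
          linarith [mul_lt_mul_of_pos_left hx hδ]
      _ = _ := by simp only [hquad, Finset.sum_div, smul_eq_mul, div_mul_div_comm]
  calc (1 : ℝ) = Real.exp (-(1 / (3 * δ))) * Real.exp (1 / (3 * δ)) := by
        rw [← Real.exp_add, neg_add_cancel, Real.exp_zero]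
    _ ≤ _ := by gcongr; exact (Real.exp_le_exp.2 hmean).trans hjensen

theorem lintegral_tail_le (D : Matrix (Fin p) (Fin n) ℝ) (F : Matrix (Fin q) (Fin n) ℝ)
    {t δ a c : ℝ} (hδ : 0 < δ) (ha : 0 ≤ a) (hc : 0 ≤ c) (ht : (D * Dᵀ).trace ≤ δ * t) :
    ∫⁻ x in {x | t < (D *ᵥ x) ⬝ᵥ (D *ᵥ x)},
        ENNReal.ofReal (a + c * ((F *ᵥ x) ⬝ᵥ (F *ᵥ x))) ∂(stdNormal n) ≤
      ENNReal.ofReal (Real.exp (-(1 / (3 * δ))) * (√3 * (a + 6 * c * (F * Fᵀ).trace))) := by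
  set s := (D * Dᵀ).trace with hs
  have hw (i : Fin p) : 0 ≤ (D i ⬝ᵥ D i) / s :=
    div_nonneg (dotProduct_self_nonneg _) (trace_mul_transpose_self_nonneg D)
  have hpos (x : Fin n → ℝ) : 0 ≤ a + c * ((F *ᵥ x) ⬝ᵥ (F *ᵥ x)) :=
    add_nonneg ha (mul_nonneg hc (dotProduct_self_nonneg _))
  calc _ ≤ ∫⁻ x, ENNReal.ofReal (Real.exp (-(1 / (3 * δ)))) * ∑ i, ENNReal.ofReal
          ((D i ⬝ᵥ D i) / s) * ENNReal.ofReal ((a + c * ((F *ᵥ x) ⬝ᵥ (F *ᵥ x))) *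
            Real.exp (unitFunctional (D i) x ^ 2 / 3)) ∂(stdNormal n) := by
        refine (setLIntegral_mono (by fun_prop) fun x hx => ?_).trans
          (setLIntegral_le_lintegral _ _)
        have h := mul_le_mul_of_nonneg_left (one_le_exp_mul_sum_exp D hδ ht hx) (hpos x)
        rw [mul_one, mul_left_comm, Finset.mul_sum] at h
        simp only [mul_left_comm (a + _)] at h
        refine (ENNReal.ofReal_le_ofReal h).trans_eq ?_
        rw [ENNReal.ofReal_mul (by positivity), ENNReal.ofReal_sum_of_nonneg fun i _ =>
          mul_nonneg (hw i) (mul_nonneg (hpos x) (by positivity))]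
        simp only [ENNReal.ofReal_mul (hw _)]
    _ = ENNReal.ofReal (Real.exp (-(1 / (3 * δ)))) * ∑ i, ENNReal.ofReal ((D i ⬝ᵥ D i) / s) *
          ∫⁻ x, ENNReal.ofReal ((a + c * ((F *ᵥ x) ⬝ᵥ (F *ᵥ x))) *
            Real.exp (unitFunctional (D i) x ^ 2 / 3)) ∂(stdNormal n) := by
        rw [lintegral_const_mul _ (by fun_prop), lintegral_finsetSum _ fun i _ => by fun_prop]
        congr! with i
        rw [lintegral_const_mul _ (by fun_prop)]
    _ ≤ ENNReal.ofReal (Real.exp (-(1 / (3 * δ)))) * ∑ i, ENNReal.ofReal ((D i ⬝ᵥ D i) / s) *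
          ENNReal.ofReal (√3 * (a + 6 * c * (F * Fᵀ).trace)) := by
        gcongr with i
        exact lintegral_add_mul_mul_exp_le F (D i) ha hc
    _ ≤ ENNReal.ofReal (Real.exp (-(1 / (3 * δ)))) *
          ENNReal.ofReal (√3 * (a + 6 * c * (F * Fᵀ).trace)) := by
        rw [← Finset.sum_mul, ← ENNReal.ofReal_sum_of_nonneg fun i _ => hw i, ← Finset.sum_div,
          ← trace_mul_transpose_self, ← hs]
        gcongr
        exact mul_le_of_le_one_left' (ENNReal.ofReal_le_one.2 (div_self_le_one s))
    _ = _ := (ENNReal.ofReal_mul (by positivity)).symm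

end GaussianTail

section Bayes

theorem ofReal_variance_le_lintegral_sq_sub {Ω : Type*} {mΩ : MeasurableSpace Ω} {μ : Measure Ω}
    [IsProbabilityMeasure μ] {X Y : Ω → ℝ} (hX : MemLp X 2 μ) (hY : AEMeasurable Y μ)
    (hXY : IndepFun X Y μ) :
    ENNReal.ofReal Var[X; μ] ≤ ∫⁻ ω, ENNReal.ofReal ((Y ω - X ω) ^ 2) ∂μ := by
  have hYX : AEStronglyMeasurable (fun ω => Y ω - X ω) μ := by
    have := hX.aemeasurable
    fun_prop
  by_cases hint : Integrable (fun ω => (Y ω - X ω) ^ 2) μ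
  · have hdiff : MemLp (fun ω => Y ω - X ω) 2 μ := (memLp_two_iff_integrable_sq hYX).2 hint
    have hYL : MemLp Y 2 μ := by simpa [Pi.add_def] using hdiff.add hX
    rw [← ofReal_integral_eq_lintegral_ofReal hint (ae_of_all _ fun ω => sq_nonneg _)]
    refine ENNReal.ofReal_le_ofReal ?_
    calc Var[X; μ] ≤ Var[Y; μ] - 2 * cov[Y, X; μ] + Var[X; μ] := by
          rw [hXY.symm.covariance_eq_zero hYL hX]
          linarith [variance_nonneg Y μ]
      _ = Var[fun ω => Y ω - X ω; μ] := (variance_fun_sub hYL hX).symm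
      _ ≤ ∫ ω, (Y ω - X ω) ^ 2 ∂μ := variance_le_expectation_sq hYX
  · have htop : ∫⁻ ω, ENNReal.ofReal ((Y ω - X ω) ^ 2) ∂μ = ⊤ := by
      contrapose! hint
      exact (lintegral_ofReal_ne_top_iff_integrable (hYX.pow 2)
        (ae_of_all _ fun ω => sq_nonneg _)).1 hint
    exact le_top.trans_eq htop.symm

variable {N m p q ν : ℕ}

theorem covariance_dotProduct_fst_add_dotProduct_snd (a a' : Fin N → ℝ) (b b' : Fin m → ℝ) :
    cov[fun z : (Fin N → ℝ) × (Fin m → ℝ) => a ⬝ᵥ z.1 + b ⬝ᵥ z.2, fun z => a' ⬝ᵥ z.1 + b' ⬝ᵥ z.2;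
      (stdNormal N).prod (stdNormal m)] = a ⬝ᵥ a' + b ⬝ᵥ b' := by
  have hfst (c : Fin N → ℝ) := (memLp_dotProduct_stdNormal c).comp_fst (stdNormal m)
  have hsnd (c : Fin m → ℝ) := (memLp_dotProduct_stdNormal c).comp_snd (stdNormal N)
  simp only [← Pi.add_def]
  rw [covariance_add_left (hfst a) (hsnd b) ((hfst a').add (hsnd b')),
    covariance_add_right (hfst a) (hfst a') (hsnd b'),
    covariance_add_right (hsnd b) (hfst a') (hsnd b'),
    covariance_fst_snd_prod (memLp_dotProduct_stdNormal a) (memLp_dotProduct_stdNormal b'),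
    covariance_comm (fun z : (Fin N → ℝ) × (Fin m → ℝ) => b ⬝ᵥ z.2) fun z => a' ⬝ᵥ z.1,
    covariance_fst_snd_prod (memLp_dotProduct_stdNormal a') (memLp_dotProduct_stdNormal b),
    measurePreserving_fst.hasLaw.covariance_fun_comp (f := fun x => a ⬝ᵥ x)
      (g := fun x => a' ⬝ᵥ x) (by fun_prop) (by fun_prop),
    measurePreserving_snd.hasLaw.covariance_fun_comp (f := fun x => b ⬝ᵥ x)
      (g := fun x => b' ⬝ᵥ x) (by fun_prop) (by fun_prop),
    covariance_dotProduct_stdNormal, covariance_dotProduct_stdNormal, add_zero, zero_add]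

theorem hasGaussianLaw_mulVec_fst_add_mulVec_snd (F : Matrix (Fin p) (Fin N) ℝ)
    (F' : Matrix (Fin p) (Fin m) ℝ) (G : Matrix (Fin q) (Fin N) ℝ) (G' : Matrix (Fin q) (Fin m) ℝ) :
    HasGaussianLaw (fun z : (Fin N → ℝ) × (Fin m → ℝ) =>
        (F *ᵥ z.1 + F' *ᵥ z.2, G *ᵥ z.1 + G' *ᵥ z.2))
      ((stdNormal N).prod (stdNormal m)) :=
  (IsGaussian.hasGaussianLaw_id (μ := (stdNormal N).prod (stdNormal m))).map_fun
    ((F.mulVecLin.coprod F'.mulVecLin).prod (G.mulVecLin.coprod G'.mulVecLin)).toContinuousLinearMap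

theorem indepFun_mulVec_fst_add_mulVec_snd {F : Matrix (Fin p) (Fin N) ℝ}
    {F' : Matrix (Fin p) (Fin m) ℝ} {G : Matrix (Fin q) (Fin N) ℝ} {G' : Matrix (Fin q) (Fin m) ℝ}
    (h : F * Gᵀ + F' * G'ᵀ = 0) :
    IndepFun (fun z => F *ᵥ z.1 + F' *ᵥ z.2) (fun z => G *ᵥ z.1 + G' *ᵥ z.2)
      ((stdNormal N).prod (stdNormal m)) :=
  (hasGaussianLaw_mulVec_fst_add_mulVec_snd F F' G G').indepFun_of_covariance_eval fun i j =>
    (covariance_dotProduct_fst_add_dotProduct_snd (F i) (G j) (F' i) (G' j)).trans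
      (congrFun₂ h i j)

theorem ofReal_trace_add_trace_le_lintegral {F : Matrix (Fin p) (Fin N) ℝ}
    {F' : Matrix (Fin p) (Fin m) ℝ} {G : Matrix (Fin q) (Fin N) ℝ} {G' : Matrix (Fin q) (Fin m) ℝ}
    (h : F * Gᵀ + F' * G'ᵀ = 0) {g : (Fin q → ℝ) → (Fin p → ℝ)} (hg : Measurable g) :
    ENNReal.ofReal ((F * Fᵀ).trace + (F' * F'ᵀ).trace) ≤
      ∫⁻ z, ENNReal.ofReal (∑ i, (g (G *ᵥ z.1 + G' *ᵥ z.2) i - (F *ᵥ z.1 + F' *ᵥ z.2) i) ^ 2)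
        ∂((stdNormal N).prod (stdNormal m)) := by
  have hX (i : Fin p) : MemLp (fun z : (Fin N → ℝ) × (Fin m → ℝ) => (F *ᵥ z.1 + F' *ᵥ z.2) i) 2
      ((stdNormal N).prod (stdNormal m)) :=
    ((memLp_dotProduct_stdNormal (F i)).comp_fst _).add
      ((memLp_dotProduct_stdNormal (F' i)).comp_snd _)
  have hG : Measurable fun z : (Fin N → ℝ) × (Fin m → ℝ) => G *ᵥ z.1 + G' *ᵥ z.2 := by fun_prop
  have hgi (i : Fin p) : Measurable fun ω => g ω i := by fun_prop
  have hvar (i : Fin p) : Var[fun z => (F *ᵥ z.1 + F' *ᵥ z.2) i;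
      (stdNormal N).prod (stdNormal m)] = F i ⬝ᵥ F i + F' i ⬝ᵥ F' i := by
    rw [← covariance_self (hX i).aemeasurable]
    exact covariance_dotProduct_fst_add_dotProduct_snd (F i) (F i) (F' i) (F' i)
  simp only [ENNReal.ofReal_sum_of_nonneg fun _ _ => sq_nonneg _]
  rw [lintegral_finsetSum _ fun i _ => by fun_prop, trace_mul_transpose_self,
    trace_mul_transpose_self, ← Finset.sum_add_distrib, ENNReal.ofReal_sum_of_nonneg fun i _ =>
      add_nonneg (dotProduct_self_nonneg (F i)) (dotProduct_self_nonneg (F' i))]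
  refine Finset.sum_le_sum fun i _ => ?_
  rw [← hvar]
  exact ofReal_variance_le_lintegral_sq_sub (hX i) ((hgi i).comp hG).aemeasurable
    ((indepFun_mulVec_fst_add_mulVec_snd h).comp (measurable_pi_apply i) (hgi i))

theorem exists_normal_equation (A : Matrix (Fin m) (Fin N) ℝ) (B : Matrix (Fin ν) (Fin N) ℝ)
    {σ : ℝ} (hσ : σ ≠ 0) {Q : Matrix (Fin N) (Fin N) ℝ} (hQ : Q.PosSemidef) :
    ∃ H : Matrix (Fin m) (Fin ν) ℝ, (B - Hᵀ * A) * Q * Aᵀ = σ ^ 2 • Hᵀ := by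
  set G := A * Q * Aᵀ + σ ^ 2 • (1 : Matrix (Fin m) (Fin m) ℝ) with hG_def
  have hG : G.PosDef :=
    (PosDef.one.smul (by positivity : 0 < σ ^ 2)).posSemidef_add
      (by simpa using hQ.mul_mul_conjTranspose_same A)
  have hinv : G⁻¹ * G = 1 := nonsing_inv_mul _ ((isUnit_iff_isUnit_det _).1 hG.isUnit)
  have hcancel : B * Q * Aᵀ * G⁻¹ * (A * Q * Aᵀ) + σ ^ 2 • (B * Q * Aᵀ * G⁻¹) = B * Q * Aᵀ := by
    calc _ = B * Q * Aᵀ * (G⁻¹ * G) := by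
          simp only [hG_def, Matrix.mul_add, Matrix.mul_smul, Matrix.mul_one, Matrix.mul_assoc]
      _ = _ := by rw [hinv, Matrix.mul_one]
  refine ⟨(B * Q * Aᵀ * G⁻¹)ᵀ, ?_⟩
  rw [transpose_transpose, Matrix.sub_mul, Matrix.sub_mul, sub_eq_iff_eq_add']
  simpa only [Matrix.mul_assoc] using hcancel.symm

/-- With `x = C ζ`, the choice of `H` by the normal equation makes the observation
`A C ζ + σ ξ` independent of the residual `(B - Hᵀ A) C ζ - σ Hᵀ ξ` of the linear estimate. -/
theorem exists_linearCost_le_lintegral_meanSqError (A : Matrix (Fin m) (Fin N) ℝ)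
    (B : Matrix (Fin ν) (Fin N) ℝ) {σ : ℝ} (hσ : σ ≠ 0) (C : Matrix (Fin N) (Fin N) ℝ)
    {w : (Fin m → ℝ) → (Fin ν → ℝ)} (hw : Measurable w) :
    ∃ H : Matrix (Fin m) (Fin ν) ℝ, ENNReal.ofReal (linearCost A B σ (C * Cᵀ) H) ≤
      ∫⁻ ζ, meanSqError A B σ w (C *ᵥ ζ) ∂(stdNormal N) := by
  have hQ : (C * Cᵀ).PosSemidef := by simpa using posSemidef_self_mul_conjTranspose C
  obtain ⟨H, hH⟩ := exists_normal_equation A B hσ hQ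
  have horth : ((B - Hᵀ * A) * C) * (A * C)ᵀ +
      (-σ • Hᵀ) * (σ • (1 : Matrix (Fin m) (Fin m) ℝ))ᵀ = 0 := by
    rw [transpose_mul, ← Matrix.mul_assoc, Matrix.mul_assoc _ C, hH]
    simp [smul_smul, sq]
  have hcost : linearCost A B σ (C * Cᵀ) H = (((B - Hᵀ * A) * C) * ((B - Hᵀ * A) * C)ᵀ).trace +
      ((-σ • Hᵀ) * (-σ • Hᵀ)ᵀ).trace := by
    simp only [linearCost, transpose_mul, transpose_smul, transpose_transpose, Matrix.mul_assoc,
      smul_mul, Matrix.mul_smul, trace_smul, smul_eq_mul]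
    ring
  refine ⟨H, ?_⟩
  rw [hcost]
  refine (ofReal_trace_add_trace_le_lintegral horth (g := fun ω => w ω - Hᵀ *ᵥ ω)
    (by fun_prop)).trans_eq ?_
  rw [lintegral_prod _ (by fun_prop)]
  refine lintegral_congr fun ζ => lintegral_congr fun ξ => ?_
  congr! 3 with i
  simp only [← mulVec_mulVec, sub_mulVec, smul_mulVec, one_mulVec, mulVec_add, mulVec_smul,
    Pi.sub_apply, Pi.add_apply, Pi.smul_apply, smul_eq_mul]
  ring

end Bayes

section Risk

variable {N m ν K : ℕ} {A : Matrix (Fin m) (Fin N) ℝ} {B : Matrix (Fin ν) (Fin N) ℝ}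
  {S : Matrix (Fin N) (Fin N) ℝ} {σ : ℝ} {Sk : Fin K → Matrix (Fin N) (Fin N) ℝ}
  {T : Set (Fin K → ℝ)}

theorem linearEstimate_meanSqError (A : Matrix (Fin m) (Fin N) ℝ) (B : Matrix (Fin ν) (Fin N) ℝ)
    (σ : ℝ) (H : Matrix (Fin m) (Fin ν) ℝ) (y : Fin N → ℝ) :
    meanSqError A B σ (linearEstimate H) y =
      ENNReal.ofReal (((B - Hᵀ * A) *ᵥ y) ⬝ᵥ ((B - Hᵀ * A) *ᵥ y) +
        σ ^ 2 * (Hᵀ * H).trace) := by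
  have herror (ξ : Fin m → ℝ) (i : Fin ν) : linearEstimate H (A *ᵥ y + σ • ξ) i - (B *ᵥ y) i =
      -((B - Hᵀ * A) *ᵥ y) i + (σ • Hᵀ i) ⬝ᵥ ξ := by
    rw [linearEstimate, mulVec_add, mulVec_smul, mulVec_mulVec, sub_mulVec, smul_dotProduct,
      Pi.add_apply, Pi.sub_apply, neg_sub, sub_add_eq_add_sub]
    rfl
  have hsum : ((B - Hᵀ * A) *ᵥ y) ⬝ᵥ ((B - Hᵀ * A) *ᵥ y) + σ ^ 2 * (Hᵀ * H).trace =
      ∑ i, ((-((B - Hᵀ * A) *ᵥ y) i) ^ 2 + (σ • Hᵀ i) ⬝ᵥ (σ • Hᵀ i)) := by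
    simp only [Finset.sum_add_distrib, smul_dotProduct, dotProduct_smul, smul_eq_mul, neg_sq,
      ← mul_assoc, ← sq, ← Finset.mul_sum]
    simp only [dotProduct, sq]
    rfl
  simp only [meanSqError, herror]
  simp only [ENNReal.ofReal_sum_of_nonneg fun _ _ => sq_nonneg _]
  rw [lintegral_finsetSum _ fun i _ => by fun_prop, hsum, ENNReal.ofReal_sum_of_nonneg fun i _ =>
    add_nonneg (sq_nonneg _) (dotProduct_self_nonneg _)]
  simp only [lintegral_sq_add_dotProduct_stdNormal]

theorem DesignFeasible.meanSqError_le (hX : IsEllitopicData Sk T) (hS : S.PosSemidef) {τ : ℝ}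
    {H : Matrix (Fin m) (Fin ν) ℝ} {lam : Fin K → ℝ}
    (h : DesignFeasible A B S σ Sk T τ H lam) {y : Fin N → ℝ} {t : Fin K → ℝ} (ht : t ∈ T)
    (hy : ∀ k, y ⬝ᵥ (Sk k *ᵥ y) ≤ t k) :
    meanSqError A B σ (linearEstimate H) y ≤ ENNReal.ofReal (τ * (1 + y ⬝ᵥ (S *ᵥ y))) := by
  obtain ⟨hquad, hbound, hlam⟩ := (designFeasible_iff hX hS).1 h
  rw [linearEstimate_meanSqError]
  refine ENNReal.ofReal_le_ofReal ?_
  have hle : ∑ k, lam k * (y ⬝ᵥ (Sk k *ᵥ y)) ≤ lam ⬝ᵥ t :=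
    Finset.sum_le_sum fun k _ => mul_le_mul_of_nonneg_left (hy k) (hlam k)
  linarith [hquad y, hbound t ht]

namespace IsEllitopicData

theorem trace_le_Mstar_sq (hX : IsEllitopicData Sk T) (B : Matrix (Fin ν) (Fin N) ℝ)
    {Q : Matrix (Fin N) (Fin N) ℝ} (hQ : Q.PosSemidef) {t : Fin K → ℝ} (ht : t ∈ T)
    (h : ∀ k, (Q * Sk k).trace ≤ t k) : (B * Q * Bᵀ).trace ≤ Mstar B Sk T ^ 2 :=
  (hX.isGreatest_Mstar_sq B).2 ⟨Q, ⟨hQ, t, ht, h⟩, rfl⟩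

theorem mulVec_dotProduct_self_le_Mstar_sq (hX : IsEllitopicData Sk T)
    (B : Matrix (Fin ν) (Fin N) ℝ) {y : Fin N → ℝ} {t : Fin K → ℝ} (ht : t ∈ T)
    (hy : ∀ k, y ⬝ᵥ (Sk k *ᵥ y) ≤ t k) : (B *ᵥ y) ⬝ᵥ (B *ᵥ y) ≤ Mstar B Sk T ^ 2 := by
  have h := hX.trace_le_Mstar_sq B (by simpa using posSemidef_vecMulVec_self_star y) ht fun k =>
    (trace_vecMulVec_self_mul y (Sk k)).trans_le (hy k)
  rwa [trace_mul_cycle, trace_mul_comm, trace_vecMulVec_self_mul,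
    ← mulVec_dotProduct_mulVec_self] at h

end IsEllitopicData

/-- The metric projection onto the Euclidean ball of radius `M` about `0`; at `a = 0` the
convention `M / 0 = 0` is harmless. Clipping an estimate bounds it without raising its risk. -/
noncomputable def radialClip (M : ℝ) (a : Fin ν → ℝ) : Fin ν → ℝ := min 1 (M / √(a ⬝ᵥ a)) • a

@[fun_prop]
theorem measurable_radialClip (M : ℝ) : Measurable (radialClip (ν := ν) M) := by
  have h : Measurable fun a : Fin ν → ℝ => min 1 (M / √(a ⬝ᵥ a)) := by
    fun_prop
  exact h.smul measurable_id

theorem radialClip_dotProduct_self_le {M : ℝ} (hM : 0 ≤ M) (a : Fin ν → ℝ) :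
    radialClip M a ⬝ᵥ radialClip M a ≤ M ^ 2 := by
  set s := √(a ⬝ᵥ a) with hs
  have hc : min 1 (M / s) * s ≤ M :=
    calc min 1 (M / s) * s ≤ M / s * s :=
          mul_le_mul_of_nonneg_right (min_le_right _ _) (Real.sqrt_nonneg _)
      _ = M * (s / s) := by ring
      _ ≤ M := mul_le_of_le_one_right hM (div_self_le_one s)
  calc radialClip M a ⬝ᵥ radialClip M a = (min 1 (M / s) * s) ^ 2 := by
        rw [radialClip, smul_dotProduct, dotProduct_smul, smul_eq_mul, smul_eq_mul, mul_pow, hs,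
          Real.sq_sqrt (dotProduct_self_nonneg a)]
        ring
    _ ≤ M ^ 2 := pow_le_pow_left₀ (by positivity) hc 2

theorem dotProduct_le_sqrt_mul {M : ℝ} (hM : 0 ≤ M) (a : Fin ν → ℝ) {b : Fin ν → ℝ}
    (hb : b ⬝ᵥ b ≤ M ^ 2) : a ⬝ᵥ b ≤ √(a ⬝ᵥ a) * M := by
  have h := Real.sum_mul_le_sqrt_mul_sqrt Finset.univ a b
  simp only [sq] at h
  exact h.trans (mul_le_mul_of_nonneg_left (Real.sqrt_le_iff.2 ⟨hM, hb⟩) (Real.sqrt_nonneg _))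

theorem sum_sq_radialClip_sub_le {M : ℝ} (hM : 0 ≤ M) (a : Fin ν → ℝ) {b : Fin ν → ℝ}
    (hb : b ⬝ᵥ b ≤ M ^ 2) :
    ∑ i, (radialClip M a i - b i) ^ 2 ≤ ∑ i, (a i - b i) ^ 2 := by
  have hexpand (c : ℝ) : ∑ i, ((c • a) i - b i) ^ 2 =
      c ^ 2 * (a ⬝ᵥ a) - 2 * c * (a ⬝ᵥ b) + b ⬝ᵥ b := by
    simp only [dotProduct, Finset.mul_sum, ← Finset.sum_add_distrib, ← Finset.sum_sub_distrib,
      Pi.smul_apply, smul_eq_mul]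
    exact Finset.sum_congr rfl fun i _ => by ring
  have hone := hexpand 1
  rw [one_smul] at hone
  have hcs := dotProduct_le_sqrt_mul hM a hb
  have hss := Real.sq_sqrt (dotProduct_self_nonneg a)
  rw [radialClip, hexpand, hone]
  set s := √(a ⬝ᵥ a)
  set c := min 1 (M / s) with hc
  have hkey : 0 ≤ (1 - c) * (c * s ^ 2 - a ⬝ᵥ b) := by
    rcases le_total 1 (M / s) with h | h
    · simp [hc, min_eq_left h]
    · have hcM : M / s * s ^ 2 = s * M := by
        rcases eq_or_ne s 0 with h0 | h0
        · simp [h0]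
        · field_simp
      rw [hc, min_eq_right h]
      exact mul_nonneg (sub_nonneg.2 h) (by linarith)
  rw [← hss]
  linarith [mul_nonneg (sq_nonneg (1 - c)) (sq_nonneg s)]

theorem meanSqError_radialClip_le {M : ℝ} (hM : 0 ≤ M) (w : (Fin m → ℝ) → (Fin ν → ℝ))
    {y : Fin N → ℝ} (hy : (B *ᵥ y) ⬝ᵥ (B *ᵥ y) ≤ M ^ 2) :
    meanSqError A B σ (fun ω => radialClip M (w ω)) y ≤ meanSqError A B σ w y :=
  lintegral_mono fun _ => ENNReal.ofReal_le_ofReal (sum_sq_radialClip_sub_le hM _ hy)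

theorem meanSqError_le_of_bounded {w : (Fin m → ℝ) → (Fin ν → ℝ)} {r : ℝ}
    (hw : ∀ ω, w ω ⬝ᵥ w ω ≤ r) (y : Fin N → ℝ) :
    meanSqError A B σ w y ≤ ENNReal.ofReal (2 * r + 2 * ((B *ᵥ y) ⬝ᵥ (B *ᵥ y))) := by
  have hsq (a b : Fin ν → ℝ) : ∑ i, (a i - b i) ^ 2 ≤ 2 * (a ⬝ᵥ a) + 2 * (b ⬝ᵥ b) := by
    simp only [dotProduct, Finset.mul_sum, ← Finset.sum_add_distrib]
    exact Finset.sum_le_sum fun i _ => by linarith [sq_nonneg (a i + b i)]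
  calc meanSqError A B σ w y ≤
        ∫⁻ _, ENNReal.ofReal (2 * r + 2 * ((B *ᵥ y) ⬝ᵥ (B *ᵥ y))) ∂(stdNormal m) := by
        refine lintegral_mono fun ξ => ENNReal.ofReal_le_ofReal ((hsq _ _).trans ?_)
        linarith [hw (A *ᵥ y + σ • ξ)]
    _ = _ := by simp

theorem exists_dotProduct_mulVec_mulVec_eq {M : Matrix (Fin N) (Fin N) ℝ} (hM : M.PosSemidef)
    (C : Matrix (Fin N) (Fin N) ℝ) :
    ∃ D : Matrix (Fin N) (Fin N) ℝ, (D * Dᵀ).trace = (C * Cᵀ * M).trace ∧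
      ∀ x, (C *ᵥ x) ⬝ᵥ (M *ᵥ (C *ᵥ x)) = (D *ᵥ x) ⬝ᵥ (D *ᵥ x) := by
  obtain ⟨G, rfl⟩ := exists_eq_mul_transpose hM
  refine ⟨Gᵀ * C, ?_, fun x => ?_⟩
  · rw [transpose_mul, transpose_transpose, ← Matrix.mul_assoc, trace_mul_comm,
      Matrix.mul_assoc Gᵀ, ← Matrix.mul_assoc G, trace_mul_comm]
  · rw [← mulVec_mulVec x Gᵀ C, mulVec_dotProduct_mulVec_self, transpose_transpose]

theorem lintegral_le_setLIntegral_compl_add_sum {Ω κ : Type*} [Fintype κ] {mΩ : MeasurableSpace Ω}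
    (μ : Measure Ω) (f : Ω → ℝ≥0∞) (s : κ → Set Ω) :
    ∫⁻ ω, f ω ∂μ ≤ ∫⁻ ω in (⋃ k, s k)ᶜ, f ω ∂μ + ∑ k, ∫⁻ ω in s k, f ω ∂μ := by
  calc ∫⁻ ω, f ω ∂μ = ∫⁻ ω in (⋃ k, s k)ᶜ ∪ ⋃ k, s k, f ω ∂μ := by
        rw [Set.compl_union_self, Measure.restrict_univ]
    _ ≤ _ := (lintegral_union_le _ _ _).trans
        (add_le_add le_rfl ((lintegral_iUnion_le s f).trans_eq (tsum_fintype _)))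

/-- The bound on the contribution to the Bayes risk of an `M`-bounded estimate under the prior
`𝒩(0, δ Q)` of the event that the signal violates one of the `K` ellitope constraints. -/
noncomputable def tailError (K : ℕ) (M δ : ℝ) : ℝ :=
  K * (Real.exp (-(1 / (3 * δ))) * (√3 * (2 * M ^ 2 + 12 * δ * M ^ 2)))

theorem setLIntegral_meanSqError_le {w : (Fin m → ℝ) → (Fin ν → ℝ)} {R : ℝ} (hR : 0 ≤ R)
    (hS : S.PosSemidef) {t : Fin K → ℝ} (C : Matrix (Fin N) (Fin N) ℝ)
    (hrisk : ∀ y : Fin N → ℝ, (∀ k, y ⬝ᵥ (Sk k *ᵥ y) ≤ t k) →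
      meanSqError A B σ w y ≤ ENNReal.ofReal (R * (1 + y ⬝ᵥ (S *ᵥ y)))) :
    ∫⁻ ζ in (⋃ k, {ζ | t k < (C *ᵥ ζ) ⬝ᵥ (Sk k *ᵥ (C *ᵥ ζ))})ᶜ,
        meanSqError A B σ w (C *ᵥ ζ) ∂(stdNormal N) ≤
      ENNReal.ofReal (R * (1 + (C * Cᵀ * S).trace)) := by
  obtain ⟨G, hGtr, hG⟩ := exists_dotProduct_mulVec_mulVec_eq hS C
  have hpos (ζ : Fin N → ℝ) : 0 ≤ (G *ᵥ ζ) ⬝ᵥ (G *ᵥ ζ) := dotProduct_self_nonneg _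
  calc _ ≤ ∫⁻ ζ, ENNReal.ofReal (R * (1 + (G *ᵥ ζ) ⬝ᵥ (G *ᵥ ζ))) ∂(stdNormal N) := by
        refine (setLIntegral_mono (by fun_prop) fun ζ hζ => ?_).trans
          (setLIntegral_le_lintegral _ _)
        rw [← hG]
        exact hrisk _ (by simpa using hζ)
    _ = ENNReal.ofReal (R * (1 + (G * Gᵀ).trace)) := by
        simp only [ENNReal.ofReal_mul hR, ENNReal.ofReal_add zero_le_one (hpos _)]
        rw [lintegral_const_mul _ (by fun_prop), lintegral_add_left measurable_const,
          lintegral_mulVec_dotProduct_self_stdNormal,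
          ENNReal.ofReal_add zero_le_one (trace_mul_transpose_self_nonneg G)]
        simp
    _ = _ := by rw [hGtr]

theorem setLIntegral_meanSqError_tail_le {w : (Fin m → ℝ) → (Fin ν → ℝ)} {M δ t : ℝ}
    (hw : ∀ ω, w ω ⬝ᵥ w ω ≤ M ^ 2) (hδ : 0 < δ) {C E : Matrix (Fin N) (Fin N) ℝ}
    (hE : E.PosSemidef) (hCE : (C * Cᵀ * E).trace ≤ δ * t)
    (hCB : (B * (C * Cᵀ) * Bᵀ).trace ≤ δ * M ^ 2) :
    ∫⁻ ζ in {ζ | t < (C *ᵥ ζ) ⬝ᵥ (E *ᵥ (C *ᵥ ζ))}, meanSqError A B σ w (C *ᵥ ζ) ∂(stdNormal N) ≤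
      ENNReal.ofReal (Real.exp (-(1 / (3 * δ))) * (√3 * (2 * M ^ 2 + 12 * δ * M ^ 2))) := by
  obtain ⟨D, hDtr, hD⟩ := exists_dotProduct_mulVec_mulVec_eq hE C
  have hBC : (B * C * (B * C)ᵀ).trace ≤ δ * M ^ 2 := by
    rwa [transpose_mul, ← Matrix.mul_assoc, Matrix.mul_assoc B C]
  simp only [hD]
  calc _ ≤ ∫⁻ ζ in {ζ | t < (D *ᵥ ζ) ⬝ᵥ (D *ᵥ ζ)},
          ENNReal.ofReal (2 * M ^ 2 + 2 * (((B * C) *ᵥ ζ) ⬝ᵥ ((B * C) *ᵥ ζ))) ∂(stdNormal N) := by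
        refine setLIntegral_mono (by fun_prop) fun ζ _ => ?_
        rw [← mulVec_mulVec]
        exact meanSqError_le_of_bounded hw _
    _ ≤ ENNReal.ofReal (Real.exp (-(1 / (3 * δ))) *
          (√3 * (2 * M ^ 2 + 6 * 2 * (B * C * (B * C)ᵀ).trace))) :=
        lintegral_tail_le D (B * C) hδ (by positivity) zero_le_two (hDtr.trans_le hCE)
    _ ≤ _ := by
        refine ENNReal.ofReal_le_ofReal ?_
        have hsum : 2 * M ^ 2 + 6 * 2 * (B * C * (B * C)ᵀ).trace ≤ 2 * M ^ 2 + 12 * δ * M ^ 2 := by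
          linarith
        exact mul_le_mul_of_nonneg_left (mul_le_mul_of_nonneg_left hsum (Real.sqrt_nonneg 3))
          (Real.exp_pos _).le

theorem lintegral_meanSqError_le (hX : IsEllitopicData Sk T) (hS : S.PosSemidef)
    {w : (Fin m → ℝ) → (Fin ν → ℝ)} {M R δ : ℝ} (hw : ∀ ω, w ω ⬝ᵥ w ω ≤ M ^ 2) (hR : 0 ≤ R)
    (hδ : 0 < δ) {t : Fin K → ℝ} {C : Matrix (Fin N) (Fin N) ℝ}
    (hCt : ∀ k, (C * Cᵀ * Sk k).trace ≤ δ * t k) (hCB : (B * (C * Cᵀ) * Bᵀ).trace ≤ δ * M ^ 2)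
    (hrisk : ∀ y : Fin N → ℝ, (∀ k, y ⬝ᵥ (Sk k *ᵥ y) ≤ t k) →
      meanSqError A B σ w y ≤ ENNReal.ofReal (R * (1 + y ⬝ᵥ (S *ᵥ y)))) :
    ∫⁻ ζ, meanSqError A B σ w (C *ᵥ ζ) ∂(stdNormal N) ≤
      ENNReal.ofReal (R * (1 + (C * Cᵀ * S).trace) + tailError K M δ) := by
  have hq : 0 ≤ (C * Cᵀ * S).trace :=
    trace_mul_nonneg (by simpa using posSemidef_self_mul_conjTranspose C) hS
  refine (lintegral_le_setLIntegral_compl_add_sum _ _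
    fun k => {ζ | t k < (C *ᵥ ζ) ⬝ᵥ (Sk k *ᵥ (C *ᵥ ζ))}).trans ?_
  refine (add_le_add (setLIntegral_meanSqError_le hR hS C hrisk) (Finset.sum_le_sum fun k _ =>
    setLIntegral_meanSqError_tail_le hw hδ (hX.posSemidef k) (hCt k) hCB)).trans_eq ?_
  rw [ENNReal.ofReal_add (by positivity) (by unfold tailError; positivity), tailError,
    ENNReal.ofReal_mul (Nat.cast_nonneg K)]
  simp

theorem mul_le_add_tailError_of_bounded (hσ : σ ≠ 0) (hX : IsEllitopicData Sk T) (hS : S.PosSemidef)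
    {τ : ℝ} (hτ : ∀ (H : Matrix (Fin m) (Fin ν) ℝ) lam, ¬DesignFeasible A B S σ Sk T τ H lam)
    {w : (Fin m → ℝ) → (Fin ν → ℝ)} (hw : Measurable w)
    (hwM : ∀ ω, w ω ⬝ᵥ w ω ≤ Mstar B Sk T ^ 2) {R : ℝ} (hR : 0 ≤ R)
    (hrisk : ∀ y : Fin N → ℝ, ∀ t ∈ T, (∀ k, y ⬝ᵥ (Sk k *ᵥ y) ≤ t k) →
      meanSqError A B σ w y ≤ ENNReal.ofReal (R * (1 + y ⬝ᵥ (S *ᵥ y))))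
    {δ : ℝ} (hδ : 0 < δ) (hδ1 : δ ≤ 1) : δ * τ ≤ R + tailError K (Mstar B Sk T) δ := by
  obtain ⟨Q, hQ, ⟨t, ht, hQt⟩, hlf⟩ := exists_leastFavorable hX hS hτ
  obtain ⟨C, hC⟩ := exists_eq_mul_transpose (hQ.smul hδ.le)
  obtain ⟨H, hH⟩ := exists_linearCost_le_lintegral_meanSqError A B hσ C hw
  have hCt (k : Fin K) : (C * Cᵀ * Sk k).trace ≤ δ * t k := by
    rw [← hC, smul_mul, trace_smul]
    exact mul_le_mul_of_nonneg_left (hQt k) hδ.le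
  have hCB : (B * (C * Cᵀ) * Bᵀ).trace ≤ δ * Mstar B Sk T ^ 2 := by
    rw [← hC, Matrix.mul_smul, smul_mul, trace_smul]
    exact mul_le_mul_of_nonneg_left (hX.trace_le_Mstar_sq B hQ ht hQt) hδ.le
  have hq : 0 ≤ (Q * S).trace := trace_mul_nonneg hQ hS
  have hε : 0 ≤ tailError K (Mstar B Sk T) δ := by unfold tailError; positivity
  have hbayes := hH.trans (lintegral_meanSqError_le hX hS hwM hR hδ hCt hCB fun y => hrisk y t ht)
  rw [← hC, smul_mul, trace_smul, smul_eq_mul, ENNReal.ofReal_le_ofReal_iff (by positivity)]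
    at hbayes
  refine le_of_mul_le_mul_right ?_ (by positivity : 0 < 1 + (Q * S).trace)
  calc δ * τ * (1 + (Q * S).trace) ≤ δ * linearCost A B σ Q H := by
        rw [mul_assoc]
        exact mul_le_mul_of_nonneg_left (hlf H) hδ.le
    _ ≤ linearCost A B σ (δ • Q) H := mul_linearCost_le_linearCost_smul Q H hδ1
    _ ≤ R * (1 + δ * (Q * S).trace) + tailError K (Mstar B Sk T) δ := hbayes
    _ ≤ R * (1 + 1 * (Q * S).trace) + tailError K (Mstar B Sk T) δ * (1 + (Q * S).trace) := by
        gcongr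
        exact le_mul_of_one_le_right hε (by linarith)
    _ = (R + tailError K (Mstar B Sk T) δ) * (1 + (Q * S).trace) := by ring

theorem mul_le_add_tailError (hσ : σ ≠ 0) (hX : IsEllitopicData Sk T) (hS : S.PosSemidef) {τ : ℝ}
    (hτ : ∀ (H : Matrix (Fin m) (Fin ν) ℝ) lam, ¬DesignFeasible A B S σ Sk T τ H lam)
    {w : (Fin m → ℝ) → (Fin ν → ℝ)} (hw : Measurable w) {R : ℝ} (hR : 0 ≤ R)
    (hrisk : ∀ y : Fin N → ℝ, ∀ t ∈ T, (∀ k, y ⬝ᵥ (Sk k *ᵥ y) ≤ t k) →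
      meanSqError A B σ w y ≤ ENNReal.ofReal (R * (1 + y ⬝ᵥ (S *ᵥ y))))
    {δ : ℝ} (hδ : 0 < δ) (hδ1 : δ ≤ 1) : δ * τ ≤ R + tailError K (Mstar B Sk T) δ := by
  have hM : 0 ≤ Mstar B Sk T := Real.sqrt_nonneg _
  exact mul_le_add_tailError_of_bounded hσ hX hS hτ (w := fun ω => radialClip (Mstar B Sk T) (w ω))
    (by fun_prop) (fun _ => radialClip_dotProduct_self_le hM _) hR
    (fun y t ht hy => (meanSqError_radialClip_le hM w
      (hX.mulVec_dotProduct_self_le_Mstar_sq B ht hy)).trans (hrisk y t ht hy)) hδ hδ1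

end Risk

section Minimax

theorem exp_neg_one_div_three_mul_le {δ : ℝ} (hδ : 0 < δ) :
    Real.exp (-(1 / (3 * δ))) ≤ 18 * δ ^ 2 := by
  rw [Real.exp_neg, inv_le_comm₀ (Real.exp_pos _) (by positivity)]
  have h0 : 0 ≤ 1 / (3 * δ) := by positivity
  calc (18 * δ ^ 2)⁻¹ = (1 / (3 * δ)) ^ 2 / 2 := by
        field_simp
        norm_num
    _ ≤ 1 + 1 / (3 * δ) + (1 / (3 * δ)) ^ 2 / 2 := by linarith
    _ ≤ Real.exp (1 / (3 * δ)) := Real.quadratic_le_exp_of_nonneg h0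

theorem tailError_le_mul_sq (K : ℕ) (M : ℝ) {δ : ℝ} (hδ : 0 < δ) (hδ1 : δ ≤ 1) :
    tailError K M δ ≤ 252 * √3 * K * M ^ 2 * δ ^ 2 := by
  have hM : 12 * δ * M ^ 2 ≤ 12 * M ^ 2 :=
    mul_le_mul_of_nonneg_right (by linarith) (sq_nonneg M)
  calc tailError K M δ ≤ K * (18 * δ ^ 2 * (√3 * (14 * M ^ 2))) := by
        unfold tailError
        gcongr
        · exact exp_neg_one_div_three_mul_le hδ
        · linarith
    _ = 252 * √3 * K * M ^ 2 * δ ^ 2 := by ring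

theorem exists_tailError_lt_mul (K : ℕ) (M : ℝ) {τ : ℝ} (hτ : 0 < τ) :
    ∃ δ : ℝ, 0 < δ ∧ δ ≤ 1 ∧ tailError K M δ < δ * τ := by
  set G : ℝ := 252 * √3 * K * M ^ 2
  have hG : 0 ≤ G := by positivity
  set δ := τ / (τ + G + 1)
  have hδ : 0 < δ := by positivity
  have hδ1 : δ ≤ 1 := (div_le_one (by positivity)).2 (by linarith)
  have hδτ : δ * (τ + G + 1) = τ := div_mul_cancel₀ _ (by positivity)
  refine ⟨δ, hδ, hδ1, ?_⟩
  calc tailError K M δ ≤ δ * (G * δ) := (tailError_le_mul_sq K M hδ hδ1).trans_eq (by ring)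
    _ < δ * τ := mul_lt_mul_of_pos_left (by linarith [mul_pos hδ hτ]) hδ

theorem two_le_log_eight : 2 ≤ Real.log 8 := by
  have h : Real.log 8 = 3 * Real.log 2 := by
    rw [show (8 : ℝ) = 2 ^ 3 by norm_num, Real.log_pow]
    norm_num
  linarith [Real.log_two_gt_d9]

theorem two_le_log_eight_mul_div {K : ℕ} (hK : 0 < K) {M R : ℝ} (hR : 0 < R) (hRM : R ≤ M ^ 2) :
    2 ≤ Real.log (8 * K * M ^ 2 / R) := by
  have hK1 : (1 : ℝ) ≤ K := Nat.one_le_cast.2 hK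
  refine two_le_log_eight.trans (Real.log_le_log (by norm_num) ((le_div_iff₀ hR).2 ?_))
  calc 8 * R ≤ 8 * M ^ 2 := by linarith
    _ ≤ 8 * K * M ^ 2 := mul_le_mul_of_nonneg_right (by linarith) (sq_nonneg M)

theorem tailError_one_div_three_mul_log_le {K : ℕ} (hK : 0 < K) {M R : ℝ} (hR : 0 < R)
    (hRM : R ≤ M ^ 2) : tailError K M (1 / (3 * Real.log (8 * K * M ^ 2 / R))) ≤ R := by
  have hM2 : 0 < M ^ 2 := hR.trans_le hRM
  have hM : M ≠ 0 := (pow_ne_zero_iff two_ne_zero).1 hM2.ne'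
  have hL : 2 ≤ Real.log (8 * K * M ^ 2 / R) := two_le_log_eight_mul_div hK hR hRM
  have hexp : Real.exp (-Real.log (8 * K * M ^ 2 / R)) = R / (8 * K * M ^ 2) := by
    rw [Real.exp_neg, Real.exp_log (by positivity), inv_div]
  generalize Real.log (8 * K * M ^ 2 / R) = L at hL hexp
  have hsqrt : √3 ≤ 2 := Real.sqrt_le_iff.2 ⟨by norm_num, by norm_num⟩
  have hinv : 4 / L ≤ 2 := (div_le_iff₀ (by positivity)).2 (by linarith)
  calc tailError K M (1 / (3 * L)) = R / 8 * (√3 * (2 + 4 / L)) := by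
        rw [tailError, show 1 / (3 * (1 / (3 * L))) = L by field_simp, hexp]
        field_simp
        ring
    _ ≤ R / 8 * (2 * (2 + 2)) := by gcongr
    _ = R := by ring

theorem le_six_mul_log_mul {K : ℕ} (hK : 0 < K) {τ M R : ℝ} (hR : 0 < R) (hRM : R ≤ M ^ 2)
    (h : ∀ δ : ℝ, 0 < δ → δ ≤ 1 → δ * τ ≤ R + tailError K M δ) :
    τ ≤ 6 * Real.log (8 * K * M ^ 2 / R) * R := by
  have hL : 2 ≤ Real.log (8 * K * M ^ 2 / R) := two_le_log_eight_mul_div hK hR hRM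
  have htail := tailError_one_div_three_mul_log_le hK hR hRM
  generalize Real.log (8 * K * M ^ 2 / R) = L at hL htail ⊢
  have hδ := h (1 / (3 * L)) (by positivity) ((div_le_one (by positivity)).2 (by linarith))
  have hτ : τ / (3 * L) ≤ 2 * R := by
    rw [← one_div_mul_eq_div]
    linarith
  rw [div_le_iff₀ (by positivity)] at hτ
  linarith

theorem IsEllitopicData.card_pos {N ν K : ℕ} {Sk : Fin K → Matrix (Fin N) (Fin N) ℝ}
    {T : Set (Fin K → ℝ)} (hX : IsEllitopicData Sk T) {B : Matrix (Fin ν) (Fin N) ℝ}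
    (hB : B ≠ 0) : 0 < K := by
  refine Nat.pos_of_ne_zero fun hK => hB (Matrix.ext_of_mulVec_single fun j => ?_)
  subst hK
  have hj := hX.posDef_sum.dotProduct_mulVec_pos (x := Pi.single j 1) (by simp)
  simp at hj

variable {n N m ν K : ℕ} {A : Matrix (Fin m) (Fin n) ℝ} {B : Matrix (Fin ν) (Fin n) ℝ}
  {S : Matrix (Fin n) (Fin n) ℝ} {σ : ℝ} {P : Matrix (Fin n) (Fin N) ℝ}
  {Sk : Fin K → Matrix (Fin N) (Fin N) ℝ} {T : Set (Fin K → ℝ)}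

theorem forall_mem_ellitope_meanSqError_le_iff (w : (Fin m → ℝ) → (Fin ν → ℝ)) (R : ℝ) :
    (∀ x ∈ ellitope P Sk T,
      meanSqError A B σ w x ≤ ENNReal.ofReal (R * (1 + x ⬝ᵥ (S *ᵥ x)))) ↔
    ∀ y : Fin N → ℝ, ∀ t ∈ T, (∀ k, y ⬝ᵥ (Sk k *ᵥ y) ≤ t k) →
      meanSqError (A * P) (B * P) σ w y ≤
        ENNReal.ofReal (R * (1 + y ⬝ᵥ ((Pᵀ * S * P) *ᵥ y))) := by
  have herr (y : Fin N → ℝ) :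
      meanSqError A B σ w (P *ᵥ y) = meanSqError (A * P) (B * P) σ w y := by
    simp only [meanSqError, mulVec_mulVec]
  have hquad (y : Fin N → ℝ) : (P *ᵥ y) ⬝ᵥ (S *ᵥ (P *ᵥ y)) = y ⬝ᵥ ((Pᵀ * S * P) *ᵥ y) := by
    rw [Matrix.mul_assoc, ← mulVec_mulVec y Pᵀ, ← mulVec_mulVec y S, dotProduct_mulVec y,
      vecMul_transpose]
  constructor
  · intro h y t ht hy
    rw [← herr, ← hquad]
    exact h _ ⟨y, t, ht, rfl, hy⟩
  · rintro h x ⟨y, t, ht, rfl, hy⟩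
    rw [herr, hquad]
    exact h y t ht hy

theorem riskS_le_of_forall {X : Set (Fin n → ℝ)} {w : (Fin m → ℝ) → (Fin ν → ℝ)} {R : ℝ}
    (hR : 0 ≤ R)
    (h : ∀ x ∈ X, meanSqError A B σ w x ≤ ENNReal.ofReal (R * (1 + x ⬝ᵥ (S *ᵥ x)))) :
    riskS A B S σ X w ≤ ENNReal.ofReal √R :=
  iInf₂_le_of_le R ⟨hR, h⟩ le_rfl

theorem DesignFeasible.riskS_le (hX : IsEllitopicData Sk T) (hS : (Pᵀ * S * P).PosSemidef)
    {τ : ℝ} {H : Matrix (Fin m) (Fin ν) ℝ} {lam : Fin K → ℝ}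
    (h : DesignFeasible (A * P) (B * P) (Pᵀ * S * P) σ Sk T τ H lam) :
    riskS A B S σ (ellitope P Sk T) (linearEstimate H) ≤ ENNReal.ofReal √τ :=
  riskS_le_of_forall (h.value_nonneg hX hS) ((forall_mem_ellitope_meanSqError_le_iff _ _).2
    fun _ _ ht hy => h.meanSqError_le hX hS ht hy)

theorem riskSOpt_le_Mstar (hX : IsEllitopicData Sk T) (hS : (Pᵀ * S * P).PosSemidef) :
    riskSOpt A B S σ (ellitope P Sk T) ≤ ENNReal.ofReal (Mstar (B * P) Sk T) := by
  have hM : 0 ≤ Mstar (B * P) Sk T := Real.sqrt_nonneg _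
  have hzero (y : Fin N → ℝ) : meanSqError (A * P) (B * P) σ (fun _ => 0) y =
      ENNReal.ofReal (((B * P) *ᵥ y) ⬝ᵥ ((B * P) *ᵥ y)) := by
    simp [meanSqError, dotProduct, sq]
  refine iInf₂_le_of_le (fun _ => 0) measurable_const ?_
  rw [← Real.sqrt_sq hM]
  refine riskS_le_of_forall (sq_nonneg _) ((forall_mem_ellitope_meanSqError_le_iff _ _).2
    fun y t ht hy => ?_)
  rw [hzero]
  refine ENNReal.ofReal_le_ofReal ((hX.mulVec_dotProduct_self_le_Mstar_sq _ ht hy).trans ?_)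
  exact le_mul_of_one_le_right (sq_nonneg _) (by linarith [quadForm_nonneg hS y])

theorem mul_le_riskSOpt_sq_add_tailError (hσ : σ ≠ 0) (hX : IsEllitopicData Sk T)
    (hS : (Pᵀ * S * P).PosSemidef) {τ : ℝ}
    (hτ : ∀ (H : Matrix (Fin m) (Fin ν) ℝ) lam,
      ¬DesignFeasible (A * P) (B * P) (Pᵀ * S * P) σ Sk T τ H lam)
    {δ : ℝ} (hδ : 0 < δ) (hδ1 : δ ≤ 1) :
    δ * τ ≤ (riskSOpt A B S σ (ellitope P Sk T)).toReal ^ 2 +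
      tailError K (Mstar (B * P) Sk T) δ := by
  have hle : ENNReal.ofReal √(δ * τ - tailError K (Mstar (B * P) Sk T) δ) ≤
      riskSOpt A B S σ (ellitope P Sk T) :=
    le_iInf₂ fun w hw => le_iInf₂ fun R hR =>
      ENNReal.ofReal_le_ofReal <| Real.sqrt_le_sqrt <| sub_le_iff_le_add.2 <|
        mul_le_add_tailError hσ hX hS hτ hw hR.1
          ((forall_mem_ellitope_meanSqError_le_iff w R).1 hR.2) hδ hδ1
  have hfin : riskSOpt A B S σ (ellitope P Sk T) ≠ ⊤ :=
    ((riskSOpt_le_Mstar hX hS).trans_lt ENNReal.ofReal_lt_top).ne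
  rw [ENNReal.ofReal_le_iff_le_toReal hfin] at hle
  exact sub_le_iff_le_add.1 ((Real.sqrt_le_left ENNReal.toReal_nonneg).1 hle)

namespace DesignOptimal

variable {τ : ℝ} {H : Matrix (Fin m) (Fin ν) ℝ} {lam : Fin K → ℝ}

theorem mul_value_le (hX : IsEllitopicData Sk T) (hS : (Pᵀ * S * P).PosSemidef)
    (hσ : σ ≠ 0) (h : DesignOptimal (A * P) (B * P) (Pᵀ * S * P) σ Sk T τ H lam)
    {δ : ℝ} (hδ : 0 < δ) (hδ1 : δ ≤ 1) :
    δ * τ ≤ (riskSOpt A B S σ (ellitope P Sk T)).toReal ^ 2 +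
      tailError K (Mstar (B * P) Sk T) δ :=
  (le_div_iff₀' hδ).1 <| le_of_forall_lt_imp_le_of_dense fun τ' hτ' => (le_div_iff₀' hδ).2 <|
    mul_le_riskSOpt_sq_add_tailError hσ hX hS
      (fun H' lam' hf => hτ'.not_ge (h.2 τ' H' lam' hf)) hδ hδ1

theorem toReal_riskSOpt_pos (hX : IsEllitopicData Sk T) (hS : (Pᵀ * S * P).PosSemidef) (hσ : σ ≠ 0)
    (hB : B * P ≠ 0) (h : DesignOptimal (A * P) (B * P) (Pᵀ * S * P) σ Sk T τ H lam) :
    0 < (riskSOpt A B S σ (ellitope P Sk T)).toReal := by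
  obtain ⟨δ, hδ, hδ1, hlt⟩ := exists_tailError_lt_mul K (Mstar (B * P) Sk T)
    (h.1.value_pos hX hS hσ hB)
  have hsq : 0 < (riskSOpt A B S σ (ellitope P Sk T)).toReal ^ 2 := by
    linarith [h.mul_value_le hX hS hσ hδ hδ1]
  exact ENNReal.toReal_nonneg.lt_of_ne' (sq_pos_iff.1 hsq)

theorem sqrt_value_le (hX : IsEllitopicData Sk T) (hS : (Pᵀ * S * P).PosSemidef) (hσ : σ ≠ 0)
    (hB : B * P ≠ 0) (h : DesignOptimal (A * P) (B * P) (Pᵀ * S * P) σ Sk T τ H lam) :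
    √τ ≤ √(6 * Real.log (8 * K * Mstar (B * P) Sk T ^ 2 /
      (riskSOpt A B S σ (ellitope P Sk T)).toReal ^ 2)) *
        (riskSOpt A B S σ (ellitope P Sk T)).toReal := by
  have hpos := h.toReal_riskSOpt_pos hX hS hσ hB
  have hle : (riskSOpt A B S σ (ellitope P Sk T)).toReal ≤ Mstar (B * P) Sk T :=
    ENNReal.toReal_le_of_le_ofReal (Real.sqrt_nonneg _) (riskSOpt_le_Mstar hX hS)
  have hτ := le_six_mul_log_mul (hX.card_pos hB) (pow_pos hpos 2)
    (pow_le_pow_left₀ hpos.le hle 2) fun δ => h.mul_value_le hX hS hσ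
  refine (Real.sqrt_le_sqrt hτ).trans_eq ?_
  rw [Real.sqrt_mul' _ (sq_nonneg _), Real.sqrt_sq hpos.le]

end DesignOptimal

end Minimax

/-- The design program is solvable, the quantities in the bound are well defined, and the linear
estimate given by any optimal solution is minimax optimal in `S`-risk up to the stated factor.
For `P = 1` the lifted data `A * P`, `B * P`, `Pᵀ * S * P` are `A`, `B`, `S`. -/
theorem proposition1 {n N m ν K : ℕ}
    (A : Matrix (Fin m) (Fin n) ℝ) (B : Matrix (Fin ν) (Fin n) ℝ)
    (S : Matrix (Fin n) (Fin n) ℝ) (σ : ℝ)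
    (P : Matrix (Fin n) (Fin N) ℝ)
    (Sk : Fin K → Matrix (Fin N) (Fin N) ℝ) (T : Set (Fin K → ℝ))
    (hσ : 0 < σ) (hS : S.PosSemidef) (hX : IsEllitopicData Sk T) (hB : B * P ≠ 0) :
    (∃ (τ : ℝ) (H : Matrix (Fin m) (Fin ν) ℝ) (lam : Fin K → ℝ),
      DesignOptimal (A * P) (B * P) (Pᵀ * S * P) σ Sk T τ H lam) ∧
    IsGreatest (traceValues (B * P) Sk T) (Mstar (B * P) Sk T ^ 2) ∧
    0 < riskSOpt A B S σ (ellitope P Sk T) ∧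
    riskSOpt A B S σ (ellitope P Sk T) < ⊤ ∧
    ∀ (τ : ℝ) (H : Matrix (Fin m) (Fin ν) ℝ) (lam : Fin K → ℝ),
      DesignOptimal (A * P) (B * P) (Pᵀ * S * P) σ Sk T τ H lam →
      riskS A B S σ (ellitope P Sk T) (linearEstimate H) ≤
        ENNReal.ofReal (Real.sqrt (6 * Real.log (8 * (K : ℝ) * Mstar (B * P) Sk T ^ 2 /
          (riskSOpt A B S σ (ellitope P Sk T)).toReal ^ 2))) *
        riskSOpt A B S σ (ellitope P Sk T) := by
  have hS' : (Pᵀ * S * P).PosSemidef := by simpa using hS.conjTranspose_mul_mul_same P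
  obtain ⟨τ₀, H₀, lam₀, h₀⟩ := exists_designOptimal (A * P) (B * P) hX hS' hσ.ne'
  have hfin : riskSOpt A B S σ (ellitope P Sk T) < ⊤ :=
    (riskSOpt_le_Mstar hX hS').trans_lt ENNReal.ofReal_lt_top
  have hpos := (ENNReal.toReal_pos_iff.1 (h₀.toReal_riskSOpt_pos hX hS' hσ.ne' hB)).1
  refine ⟨⟨τ₀, H₀, lam₀, h₀⟩, hX.isGreatest_Mstar_sq (B * P), hpos, hfin, fun τ H lam h => ?_⟩
  refine (h.1.riskS_le hX hS').trans
    ((ENNReal.ofReal_le_ofReal (h.sqrt_value_le hX hS' hσ.ne' hB)).trans_eq ?_)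
  rw [ENNReal.ofReal_mul (Real.sqrt_nonneg _), ENNReal.ofReal_toReal hfin.ne]
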